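/- **Setting.** Let $\mathcal S,\mathcal A$ be finite sets, $H\ge 1$, $\llbracket H\rrbracket=\{1,\dots,H\}$. An instance is a tuple $I=(\mu_0,p,\pi^E,\pi^b)$ of an initial state distribution $\mu_0$ on $\mathcal S$, a transition model $p=(p_h(\cdot|s,a))$, a deterministic expert's policy $\pi^E=(\pi^E_h(s))$ and a (stochastic) behavioral policy $\pi^b=(\pi^b_h(\cdot|s))$. For a policy $\pi$, $\mathbb P_{p,\pi}$ is the law of the trajectory $(s_1,a_1,\dots,s_H,a_H)$ started from $\mu_0$; $\mathcal S^{p,\pi}$ is the set of $(s,h)$ with $\mathbb P_{p,\pi}(s_h=s)>0$ and $\mathcal Z^{p,\pi}$ the set of $(s,a,h)$ with $\mathbb P_{p,\pi}(s_h=s,a_h=a)>0$. All instances considered satisfy the covering assumption $\pi^b_h(\pi^E_h(s)|s)>0$ for all $(s,h)\in\mathcal S^{p,\pi^E}$. Rewards are arbitrary functions $r:\mathcal S\times\mathcal A\times\llbracket H\rrbracket\to\mathbb R$; $Q^\pi_h(s,a;p,r)$ is the expected sum of rewards from stage $h$ on when starting with $(s,a)$ and then following $\pi$, and $J(\pi;\mu_0,p,r)=\mathbb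 E_{s\sim\mu_0,a\sim\pi_1(\cdot|s)}[Q^\pi_1(s,a;p,r)]$. The feasible set and the old feasible set are $$\mathcal R_{p,\pi}=\{r: J(\pi;\mu_0,p,r)=\max_{\pi'}J(\pi';\mu_0,p,r)\},\qquad \overline{\mathcal R}_{p,\pi}=\{r:\forall s,h,a:\ \mathbb E_{a'\sim\pi_h(\cdot|s)}Q^{\pi}_h(s,a';p,r)\ge Q^{\pi}_h(s,a;p,r)\}.$$ Let $[p]$ be the set of transition models that agree with $p$ on $\mathcal Z^{p,\pi^b}$ and $[\pi^E]$ the set of policies that agree with $\pi^E$ on $\mathcal S^{p,\pi^E}$. Put $$\mathcal R^\cap_{p,\pi^E}=\bigcap_{p'\in[p]}\mathcal R_{p',\pi^E},\quad \mathcal R^\cup_{p,\pi^E}=\bigcup_{p'\in[p]}\mathcal R_{p',\pi^E},\quad \overline{\mathcal R}^\cap_{p,\pi^E}=\bigcap_{p'\in[p]}\bigcap_{\pi'\in[\pi^E]}\overline{\mathcal R}_{p',\pi'},\quad \overline{\mathcal R}^\cup_{p,\pi^E}=\bigcup_{p'\in[p]}\bigcup_{\pi'\in[\pi^E]}\overline{\mathcal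 R}_{p',\pi'}.$$ **Learnability.** Let $\mathcal C$ be a class of instances and let $\phi$ assign to every $I\in\mathcal C$ a set of rewards $\phi(I)$. Then $\phi$ is *PAC-learnable on $\mathcal C$ from $\mathbb P_{p,\pi^b}$* if there are a semimetric $d$ on sets of rewards (nonnegative, symmetric, zero exactly on the diagonal) with $d(X,Z)\le\rho\,(d(X,Y)+d(Y,Z))$ for some finite $\rho$, and an algorithm $\mathfrak A$ mapping finitely many trajectories to a set of rewards, such that for all $I\in\mathcal C$ and $\epsilon,\delta\in(0,1)$ there is $N\in\mathbb N$ such that, for every $n\ge N$, the output $\widehat\phi$ of $\mathfrak A$ on $n$ independent trajectories from $\mathbb P_{p,\pi^b}$ satisfies $\mathbb P(d(\phi(I),\widehat\phi)\le\epsilon)\ge 1-\delta$. A learnable $\phi$ on $\mathcal C$ with $\phi(I)\subseteq F(I)$ for all $I\in\mathcal C$ is the *tightest learnable subset* of $F$ on $\mathcal C$ if, for all $\mu_0,\pi^b$, every $\psi$ that is learnable on $\mathcal C'=\{I\in\mathcal C$ with this $\mu_0$ and this $\pi^b\}$ and has $\psi(I)\subseteq F(I)$ for all $I\in\mathcal C'$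 satisfies $\psi(I)\subseteq\phi(I)$ for all $I\in\mathcal C'$. The *tightest learnable superset* is defined in the same way with all inclusions reversed. **Theorem.** Fix an MDP without reward and an expert's policy $\pi^E$ with support $\mathcal S^{p,\pi^E}$. 1. If $\mathcal S^{p,\pi^E}$ and the values of $\pi^E$ on it are known (that is, $\mathcal C$ is the class of all instances satisfying the covering assumption whose expert has this support and these values on it), then $\overline{\mathcal R}^\cap_{p,\pi^E}$ and $\overline{\mathcal R}^\cup_{p,\pi^E}$ are, respectively, the tightest learnable subset and superset of $\overline{\mathcal R}_{p,\pi^E}$ on $\mathcal C$. 2. If $\mathcal S^{p,\pi^E}$ and $\pi^E$ (everywhere) are known (that is, $\mathcal C$ is the class of all instances satisfying the covering assumption with this expert's policy and this expert's support), then $\mathcal R^\cap_{p,\pi^E}$ and $\mathcal R^\cup_{p,\pi^E}$ are, respectively, the tightest learnable subset and superset of $\mathcal R_{p,\pi^E}$ on $\mathcal C$. In particular, no strictly tighter learnable set exists in any of the four cases. -/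

import Mathlib

namespace OfflineIRL

/-- Time-inhomogeneous transition models `p_h(· | s, a)`, stages numbered `0, …, H - 1`. -/
abbrev Transition (S A : Type*) [Fintype S] (H : ℕ) := Fin H → S → A → stdSimplex ℝ S

/-- Stochastic (Markov, time-inhomogeneous) policies `π_h(· | s)`. -/
abbrev Policy (S A : Type*) [Fintype A] (H : ℕ) := Fin H → S → stdSimplex ℝ A

/-- Deterministic policies. -/
abbrev DetPolicy (S A : Type*) (H : ℕ) := Fin H → S → A

/-- Real-valued reward functions, without any boundedness requirement. -/
abbrev Reward (S A : Type*) (H : ℕ) := Fin H → S → A → ℝ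

/-- Trajectories `(s_1, a_1, …, s_H, a_H)`. -/
abbrev Traj (S A : Type*) (H : ℕ) := Fin H → S × A

open Classical in
/-- A deterministic policy seen as a stochastic one. -/
noncomputable def DetPolicy.toPolicy {S A : Type*} [Fintype A] {H : ℕ}
    (π : DetPolicy S A H) : Policy S A H :=
  fun h s => ⟨Pi.single (π h s) 1, single_mem_stdSimplex ℝ (π h s)⟩

section Dynamics

variable {S A : Type*} [Fintype S] [Fintype A] {H : ℕ}

/-- The probability of a trajectory under initial distribution `μ₀`, transitions `p`
and policy `π`. -/
noncomputable def trajProb [NeZero H] (μ₀ : stdSimplex ℝ S) (p : Transition S A H)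
    (π : Policy S A H) (τ : Traj S A H) : ℝ :=
  μ₀ (τ 0).1 * ∏ h : Fin H,
    (π h (τ h).1 (τ h).2 *
      if hh : h.val + 1 < H then p h (τ h).1 (τ h).2 (τ ⟨h.val + 1, hh⟩).1 else 1)

open Classical in
/-- State-action visitation probability `ρ_h(s, a)`: the probability that the trajectory
visits `(s, a)` at stage `h`. -/
noncomputable def visitSA [NeZero H] (μ₀ : stdSimplex ℝ S) (p : Transition S A H)
    (π : Policy S A H) (h : Fin H) (s : S) (a : A) : ℝ :=
  ∑ τ : Traj S A H, if τ h = (s, a) then trajProb μ₀ p π τ else 0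

/-- State visitation probability `ρ_h(s)`. -/
noncomputable def visitS [NeZero H] (μ₀ : stdSimplex ℝ S) (p : Transition S A H)
    (π : Policy S A H) (h : Fin H) (s : S) : ℝ :=
  ∑ a : A, visitSA μ₀ p π h s a

/-- The set of pairs `(s, h)` reached with positive probability. -/
def suppS [NeZero H] (μ₀ : stdSimplex ℝ S) (p : Transition S A H)
    (π : Policy S A H) : Set (S × Fin H) :=
  {x | 0 < visitS μ₀ p π x.2 x.1}

/-- The set of triples `(s, a, h)` reached with positive probability. -/
def suppSA [NeZero H] (μ₀ : stdSimplex ℝ S) (p : Transition S A H)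
    (π : Policy S A H) : Set (S × A × Fin H) :=
  {x | 0 < visitSA μ₀ p π x.2.2 x.1 x.2.1}

/-- The Q-function `Q^π_h(s, a; p, r)`: expected sum of the rewards collected from stage `h` on,
starting with action `a` in state `s` and then following `π`. -/
noncomputable def qFun (p : Transition S A H) (π : Policy S A H) (r : Reward S A H)
    (h : Fin H) (s : S) (a : A) : ℝ :=
  r h s a +
    if hh : h.val + 1 < H then
      ∑ s' : S, p h s a s' *
        ∑ a' : A, π ⟨h.val + 1, hh⟩ s' a' * qFun p π r ⟨h.val + 1, hh⟩ s' a'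
    else 0
termination_by H - h.val

/-- The utility `J(π; μ₀, p, r)`. -/
noncomputable def utility [NeZero H] (μ₀ : stdSimplex ℝ S) (p : Transition S A H)
    (π : Policy S A H) (r : Reward S A H) : ℝ :=
  ∑ s : S, μ₀ s * ∑ a : A, π 0 s a * qFun p π r 0 s a

/-- Equivalence class of a policy: policies equal to `π` on `Sbar`. -/
def policyClass (Sbar : Set (S × Fin H)) (π : Policy S A H) : Set (Policy S A H) :=
  {π' | ∀ x ∈ Sbar, π x.2 x.1 = π' x.2 x.1}

/-- Equivalence class of a transition model: transition models equal to `p` on `Zbar`. -/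
def transClass (Zbar : Set (S × A × Fin H)) (p : Transition S A H) : Set (Transition S A H) :=
  {p' | ∀ x ∈ Zbar, p x.2.2 x.1 x.2.1 = p' x.2.2 x.1 x.2.1}

/-- The feasible set `R_{p,π}`: rewards for which `π` maximizes the utility over all policies. -/
def feasibleSet [NeZero H] (μ₀ : stdSimplex ℝ S) (p : Transition S A H) (π : Policy S A H) :
    Set (Reward S A H) :=
  {r | IsGreatest (Set.range fun π' : Policy S A H => utility μ₀ p π' r) (utility μ₀ p π r)}

/-- The old feasible set: rewards for which the action drawn from `π` is optimal with respect to
`Q^π` in every state and stage. For a deterministic `π` the left-hand sum is `Q^π_h(s, π_h(s))`. -/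
def oldFeasibleSet (p : Transition S A H) (π : Policy S A H) : Set (Reward S A H) :=
  {r | ∀ (h : Fin H) (s : S) (a : A),
    qFun p π r h s a ≤ ∑ a' : A, π h s a' * qFun p π r h s a'}

end Dynamics

/-- A problem instance: an MDP without reward (on the state space `S`, action space `A`, horizon
`H`), together with the deterministic expert's policy and the behavioral policy. -/
structure Instance (S A : Type*) [Fintype S] [Fintype A] (H : ℕ) where
  /-- initial state distribution -/
  init : stdSimplex ℝ S
  /-- transition model -/
  trans : Transition S A H
  /-- deterministic expert's policy -/
  expert : DetPolicy S A H
  /-- behavioral policy -/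
  behavior : Policy S A H

namespace Instance

variable {S A : Type*} [Fintype S] [Fintype A] {H : ℕ} [NeZero H]

/-- The support of the state visitation distribution of the expert. -/
def expertSupp (M : Instance S A H) : Set (S × Fin H) :=
  suppS M.init M.trans M.expert.toPolicy

/-- The support of the state-action visitation distribution of the behavioral policy. -/
def behaviorSupp (M : Instance S A H) : Set (S × A × Fin H) :=
  suppSA M.init M.trans M.behavior

/-- Expert's covering: on the expert's support, the behavioral policy plays the expert's action
with positive probability. -/
def Covers (M : Instance S A H) : Prop :=
  ∀ x ∈ M.expertSupp, 0 < M.behavior x.2 x.1 (M.expert x.2 x.1)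

/-- The distribution of one trajectory collected with the behavioral policy. -/
noncomputable def law (M : Instance S A H) (τ : Traj S A H) : ℝ :=
  trajProb M.init M.trans M.behavior τ

/-- The feasible set of the instance. -/
def feasible (M : Instance S A H) : Set (Reward S A H) :=
  feasibleSet M.init M.trans M.expert.toPolicy

/-- The sub-feasible set. -/
def subFeasible (M : Instance S A H) : Set (Reward S A H) :=
  ⋂ p' ∈ transClass M.behaviorSupp M.trans, feasibleSet M.init p' M.expert.toPolicy

/-- The super-feasible set. -/
def superFeasible (M : Instance S A H) : Set (Reward S A H) :=
  ⋃ p' ∈ transClass M.behaviorSupp M.trans, feasibleSet M.init p' M.expert.toPolicy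

/-- The old feasible set of the instance. -/
def oldFeasible (M : Instance S A H) : Set (Reward S A H) :=
  oldFeasibleSet M.trans M.expert.toPolicy

/-- The subset of the old feasible set. -/
def oldSubFeasible (M : Instance S A H) : Set (Reward S A H) :=
  ⋂ p' ∈ transClass M.behaviorSupp M.trans,
    ⋂ π' ∈ policyClass M.expertSupp M.expert.toPolicy, oldFeasibleSet p' π'

/-- The superset of the old feasible set. -/
def oldSuperFeasible (M : Instance S A H) : Set (Reward S A H) :=
  ⋃ p' ∈ transClass M.behaviorSupp M.trans,
    ⋃ π' ∈ policyClass M.expertSupp M.expert.toPolicy, oldFeasibleSet p' π'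

/-- The instances that a learner who knows the expert's policy everywhere and the expert's
support in `M` has to consider: everything else is unknown. -/
def sameExpert (M : Instance S A H) : Set (Instance S A H) :=
  {I | I.Covers ∧ I.expertSupp = M.expertSupp ∧ I.expert = M.expert}

/-- The instances that a learner who knows the expert's support in `M` and the expert's policy on
this support has to consider: everything else is unknown. -/
def sameExpertOnSupp (M : Instance S A H) : Set (Instance S A H) :=
  {I | I.Covers ∧ I.expertSupp = M.expertSupp ∧
    ∀ x ∈ M.expertSupp, I.expert x.2 x.1 = M.expert x.2 x.1}

end Instance

/-- Semimetrics satisfying a relaxed triangle inequality with some finite constant. -/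
structure IsRelaxedSemimetric {Φ : Type*} (d : Φ → Φ → ℝ) : Prop where
  nonneg : ∀ x y, 0 ≤ d x y
  eq_zero_iff : ∀ x y, d x y = 0 ↔ x = y
  symm : ∀ x y, d x y = d y x
  relaxed_triangle : ∃ ρ : ℝ, ∀ x y z, d x z ≤ ρ * (d x y + d y z)

/-- The probability of the event `E` under `n` independent samples from `μ`. -/
noncomputable def iidProb {X : Type*} [Fintype X] (μ : X → ℝ) {n : ℕ}
    (E : Set (Fin n → X)) : ℝ :=
  ∑ x : Fin n → X, E.indicator (fun x => ∏ i, μ (x i)) x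

section Learnability

variable {S A : Type*} [Fintype S] [Fintype A] {H : ℕ} [NeZero H]

/-- PAC-learnability of a set of rewards `φ I`, which depends on the unknown instance `I ∈ C`, from
trajectories of the behavioral policy. The semimetric and the algorithm (a map from finite samples
to sets of rewards) are shared by all instances of `C`, since the learner does not know which of
them generates the samples; the number of samples may depend on the instance. -/
def PACLearnable (C : Set (Instance S A H)) (φ : Instance S A H → Set (Reward S A H)) : Prop :=
  ∃ d : Set (Reward S A H) → Set (Reward S A H) → ℝ, IsRelaxedSemimetric d ∧
    ∃ alg : (n : ℕ) → (Fin n → Traj S A H) → Set (Reward S A H),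
      ∀ I ∈ C, ∀ ε ∈ Set.Ioo (0 : ℝ) 1, ∀ δ ∈ Set.Ioo (0 : ℝ) 1,
        ∃ N : ℕ, ∀ n ≥ N, 1 - δ ≤ iidProb I.law {x | d (φ I) (alg n x) ≤ ε}

/-- The instances of `C` with initial distribution `μ₀` and behavioral policy `πb`. -/
def slice (C : Set (Instance S A H)) (μ₀ : stdSimplex ℝ S) (πb : Policy S A H) :
    Set (Instance S A H) :=
  {I ∈ C | I.init = μ₀ ∧ I.behavior = πb}

/-- `φ` is the tightest (that is, the largest) learnable subset of `F` on the class `C`. The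
competitors `ψ` need to be learnable subsets of `F` only over the instances with a given initial
distribution and a given behavioral policy, hence they may use the knowledge of these two. -/
def IsTightestLearnableSubset (C : Set (Instance S A H))
    (F φ : Instance S A H → Set (Reward S A H)) : Prop :=
  PACLearnable C φ ∧ (∀ I ∈ C, φ I ⊆ F I) ∧
    ∀ (μ₀ : stdSimplex ℝ S) (πb : Policy S A H) (ψ : Instance S A H → Set (Reward S A H)),
      PACLearnable (slice C μ₀ πb) ψ → (∀ I ∈ slice C μ₀ πb, ψ I ⊆ F I) →
        ∀ I ∈ slice C μ₀ πb, ψ I ⊆ φ I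

/-- `φ` is the tightest (that is, the smallest) learnable superset of `F` on the class `C`, with
the same competitors as for subsets. -/
def IsTightestLearnableSuperset (C : Set (Instance S A H))
    (F φ : Instance S A H → Set (Reward S A H)) : Prop :=
  PACLearnable C φ ∧ (∀ I ∈ C, F I ⊆ φ I) ∧
    ∀ (μ₀ : stdSimplex ℝ S) (πb : Policy S A H) (ψ : Instance S A H → Set (Reward S A H)),
      PACLearnable (slice C μ₀ πb) ψ → (∀ I ∈ slice C μ₀ πb, F I ⊆ ψ I) →
        ∀ I ∈ slice C μ₀ πb, φ I ⊆ ψ I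

end Learnability

end OfflineIRL

/-! Learnability and tightness rest on one principle: the data reveal exactly the law of a
behavioral trajectory.

Learnability. Each of the four sets depends only on the behavioral support, on `μ₀` and on `p` over
that support, all determined by the law up to irrelevant last-stage transitions. For a fixed support
the dependence on `(μ₀, p)` has closed graph, because Q-functions and utilities are continuous and
the spaces of models and policies are compact. The algorithm outputs the closure of the union of `φ
I'` over all instances `I'` compatible with the empirical frequencies. With high probability this
closed set contains `φ I`, and it eventually misses any given compact set disjoint from `φ I`. Since
the semimetric may be chosen freely, it is built so that this one-sided convergence suffices
(`exists_relaxedSemimetric`, `pacLearnable_of_locally_disjoint`,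
`pacLearnable_of_isClosed_rewardGraph`).

Tightness. A learnable `ψ` is constant on instances with the same law (`PACLearnable.eq_of_law_eq`).
Changing transitions off the behavioral support, or the expert off its own support, keeps the law
and, by covering, the class. So a learnable subset lies in the intersection of `F` over all such
changes, and a learnable superset contains the union. For the old feasible set it remains to pass
between deterministic and stochastic extensions of the expert, using that greedy policies share
their Q-function. -/

namespace OfflineIRL

set_option linter.unusedSectionVars false

/-! ### A semimetric on sets adapted to closed supersets -/

section RelaxedSemimetric

variable {E : Type*}

/-- Records which members of the sequence of sets `K` are met by a given set. -/
def hitPattern (K : ℕ → Set E) (X : Set E) : ℕ → Prop := fun i => (X ∩ K i).Nonempty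

open Classical in
/-- A metric on sets: two closed sets are compared through their hit patterns, and every set which
is not closed is isolated. -/
noncomputable def hitDist [TopologicalSpace E] (K : ℕ → Set E) (X Y : Set E) : ℝ :=
  PiNat.dist.dist (hitPattern K X) (hitPattern K Y) +
    if X = Y ∨ (IsClosed X ∧ IsClosed Y) then 0 else 1

/-- The triangle inequality holds with constant 1 since being equal or both closed is a transitive
relation; `hK` is needed only to separate distinct closed sets. -/
theorem isRelaxedSemimetric_hitDist [TopologicalSpace E] (K : ℕ → Set E)
    (hK : ∀ X Y : Set E, IsClosed X → IsClosed Y → hitPattern K X = hitPattern K Y → X = Y) :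
    IsRelaxedSemimetric (hitDist K) where
  nonneg X Y := by
    unfold hitDist
    have := PiNat.dist_nonneg (hitPattern K X) (hitPattern K Y)
    split_ifs <;> linarith
  eq_zero_iff X Y := by
    constructor
    · intro h
      unfold hitDist at h
      have h0 := PiNat.dist_nonneg (hitPattern K X) (hitPattern K Y)
      split_ifs at h with hXY
      · rcases hXY with hXY | ⟨hX, hY⟩
        · exact hXY
        · exact hK X Y hX hY (PiNat.eq_of_dist_eq_zero _ _ (by linarith))
      · linarith
    · rintro rfl
      simp [hitDist, PiNat.dist_self]
  symm X Y := by
    classical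
    unfold hitDist
    rw [PiNat.dist_comm]
    exact congrArg _ (if_congr (or_congr eq_comm and_comm) rfl rfl)
  relaxed_triangle := by
    classical
    refine ⟨1, fun X Y Z => ?_⟩
    unfold hitDist
    have h := PiNat.dist_triangle (hitPattern K X) (hitPattern K Y) (hitPattern K Z)
    have h2 : (if X = Z ∨ (IsClosed X ∧ IsClosed Z) then (0 : ℝ) else 1) ≤
        (if X = Y ∨ (IsClosed X ∧ IsClosed Y) then 0 else 1) +
          (if Y = Z ∨ (IsClosed Y ∧ IsClosed Z) then 0 else 1) := by
      by_cases h1 : X = Y ∨ (IsClosed X ∧ IsClosed Y)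
      · by_cases h2 : Y = Z ∨ (IsClosed Y ∧ IsClosed Z)
        · have h3 : X = Z ∨ (IsClosed X ∧ IsClosed Z) := by
            rcases h1 with rfl | h1
            · exact h2
            · rcases h2 with rfl | h2
              · exact Or.inr h1
              · exact Or.inr ⟨h1.1, h2.2⟩
          simp [h1, h2, h3]
        · rw [if_neg h2, if_pos h1]
          split_ifs <;> norm_num
      · rw [if_neg h1]
        split_ifs <;> norm_num
    linarith

/-- On a proper separable metric space there is a semimetric on sets for which a closed superset of
a closed set `X` is close to `X` as soon as it misses a suitable compact set. -/
theorem exists_relaxedSemimetric (E : Type*) [MetricSpace E] [ProperSpace E] [Nonempty E] :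
    ∃ d : Set E → Set E → ℝ, IsRelaxedSemimetric d ∧
      ∀ X, IsClosed X → ∀ ε > 0, ∃ K, IsCompact K ∧ Disjoint X K ∧
        ∀ Y, IsClosed Y → X ⊆ Y → Disjoint Y K → d X Y ≤ ε := by
  -- Countably many balls, compact because `E` is proper, with dense centres and arbitrarily small
  -- radii: a point outside a closed set lies in one that misses the set.
  let K : ℕ → Set E := fun i => Metric.closedBall (TopologicalSpace.denseSeq E i.unpair.1)
    (1 / ((i.unpair.2 : ℝ) + 1))
  have key : ∀ X Y : Set E, IsClosed Y → hitPattern K X = hitPattern K Y → X ⊆ Y := by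
    intro X Y hY h x hx
    by_contra hxY
    obtain ⟨ε, hε, hball⟩ := Metric.isOpen_iff.1 hY.isOpen_compl x hxY
    obtain ⟨m, hm⟩ := exists_nat_one_div_lt (half_pos hε)
    have hm0 : (0 : ℝ) < 1 / ((m : ℝ) + 1) := by positivity
    obtain ⟨i, hi⟩ := (TopologicalSpace.denseRange_denseSeq E).exists_dist_lt x hm0
    have hX : hitPattern K X (Nat.pair i m) :=
      ⟨x, hx, by simpa [K] using hi.le⟩
    rw [h] at hX
    obtain ⟨y, hyY, hyK⟩ := hX
    refine hball ?_ hyY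
    simp only [K, Nat.unpair_pair, Metric.mem_closedBall] at hyK
    rw [Metric.mem_ball]
    have := dist_triangle_right y x (TopologicalSpace.denseSeq E i)
    linarith
  refine ⟨hitDist K, isRelaxedSemimetric_hitDist K fun X Y hX hY h =>
    (key X Y hY h).antisymm (key Y X hX h.symm), fun X hX ε hε => ?_⟩
  obtain ⟨m, hm⟩ := exists_pow_lt_of_lt_one hε (by norm_num : (1 / 2 : ℝ) < 1)
  -- A superset of `X` hits every ball that `X` hits. Missing this union, it hits no other among the
  -- first `m`, so the patterns agree there and their distance is at most `(1 / 2) ^ m`.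
  refine ⟨⋃ i ∈ {i ∈ Set.Iio m | Disjoint X (K i)}, K i, ?_, ?_, ?_⟩
  · exact ((Set.finite_Iio m).subset (Set.sep_subset _ _)).isCompact_biUnion
      fun i _ => isCompact_closedBall _ _
  · exact Set.disjoint_iUnion₂_right.2 fun i hi => hi.2
  · intro Y hY hXY hYK
    unfold hitDist
    rw [if_pos (Or.inr ⟨hX, hY⟩), add_zero]
    refine le_trans (PiNat.mem_cylinder_iff_dist_le.1 fun i hi => ?_) hm.le
    refine propext ⟨fun h => h.mono (Set.inter_subset_inter_left _ hXY), fun h => ?_⟩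
    by_contra hne
    have hd : Disjoint X (K i) :=
      Set.disjoint_iff_inter_eq_empty.2 (Set.not_nonempty_iff_eq_empty.1 hne)
    exact Set.not_disjoint_iff_nonempty_inter.2 h
      ((Set.disjoint_iUnion₂_right.1 hYK) i ⟨hi, hd⟩)

end RelaxedSemimetric

/-! ### Empirical frequencies of an i.i.d. sample -/

section Sampling

variable {X : Type*} [Fintype X]

theorem sum_prod_mul_eq_sum_cons (μ : X → ℝ) {n : ℕ} (g : (Fin (n + 1) → X) → ℝ) :
    ∑ x : Fin (n + 1) → X, (∏ i, μ (x i)) * g x =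
      ∑ a, μ a * ∑ x : Fin n → X, (∏ i, μ (x i)) * g (Fin.cons a x) := by
  rw [← (Fin.consEquiv fun _ : Fin (n + 1) => X).sum_comp, Fintype.sum_prod_type]
  refine Finset.sum_congr rfl fun a _ => ?_
  rw [Finset.mul_sum]
  refine Finset.sum_congr rfl fun x _ => ?_
  simp [Fin.consEquiv, Fin.prod_univ_succ, mul_assoc]

theorem sum_prod_eq_one {μ : X → ℝ} (hμ : ∑ a, μ a = 1) (n : ℕ) :
    ∑ x : Fin n → X, ∏ i, μ (x i) = 1 := by
  rw [← Fintype.sum_pow, hμ, one_pow]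

theorem sum_prod_mul_sum_eq_zero {μ f : X → ℝ} (hμ : ∑ a, μ a = 1) (hf : ∑ a, μ a * f a = 0)
    (n : ℕ) : ∑ x : Fin n → X, (∏ i, μ (x i)) * ∑ i, f (x i) = 0 := by
  induction n with
  | zero => simp
  | succ n ih =>
    rw [sum_prod_mul_eq_sum_cons]
    simp only [Fin.sum_univ_succ, Fin.cons_zero, Fin.cons_succ, mul_add, Finset.sum_add_distrib,
      ih, ← Finset.sum_mul, sum_prod_eq_one hμ n, one_mul, hf, add_zero]

/-- Additivity of the variance: the cross terms vanish by independence and centring. -/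
theorem sum_prod_mul_sum_sq {μ f : X → ℝ} (hμ : ∑ a, μ a = 1) (hf : ∑ a, μ a * f a = 0)
    (n : ℕ) :
    ∑ x : Fin n → X, (∏ i, μ (x i)) * (∑ i, f (x i)) ^ 2 = n * ∑ a, μ a * f a ^ 2 := by
  induction n with
  | zero => simp
  | succ n ih =>
    rw [sum_prod_mul_eq_sum_cons]
    have h : ∀ a, ∑ x : Fin n → X, (∏ i, μ (x i)) *
        (∑ i, f ((Fin.cons a x : Fin (n + 1) → X) i)) ^ 2 =
          f a ^ 2 + n * ∑ b, μ b * f b ^ 2 := by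
      intro a
      have h2 : ∀ x : Fin n → X, (∏ i, μ (x i)) *
          (∑ i, f ((Fin.cons a x : Fin (n + 1) → X) i)) ^ 2 =
            f a ^ 2 * ∏ i, μ (x i) + 2 * f a * ((∏ i, μ (x i)) * ∑ i, f (x i)) +
              (∏ i, μ (x i)) * (∑ i, f (x i)) ^ 2 := by
        intro x
        simp only [Fin.sum_univ_succ, Fin.cons_zero, Fin.cons_succ]
        ring
      simp only [h2, Finset.sum_add_distrib, ← Finset.mul_sum, sum_prod_eq_one hμ n,
        sum_prod_mul_sum_eq_zero hμ hf n, ih]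
      ring
    simp only [h, mul_add, Finset.sum_add_distrib, ← Finset.sum_mul, hμ]
    push_cast
    ring

open Classical in
/-- The relative frequency of `a` in the sample `x`. -/
noncomputable def freq {n : ℕ} (x : Fin n → X) (a : X) : ℝ :=
  (∑ i, if x i = a then (1 : ℝ) else 0) / n

theorem iidProb_mono {μ : X → ℝ} (hμ : ∀ a, 0 ≤ μ a) {n : ℕ} {E F : Set (Fin n → X)}
    (h : E ⊆ F) : iidProb μ E ≤ iidProb μ F :=
  Finset.sum_le_sum fun x _ =>
    Set.indicator_le_indicator_of_subset h (fun x => Finset.prod_nonneg fun i _ => hμ (x i)) x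

theorem iidProb_add_le_one {μ : X → ℝ} (hμ : ∀ a, 0 ≤ μ a) {n : ℕ} {E F : Set (Fin n → X)}
    (h : Disjoint E F) (hsum : ∑ a, μ a = 1) : iidProb μ E + iidProb μ F ≤ 1 := by
  unfold iidProb
  rw [← sum_prod_eq_one hsum n, ← Finset.sum_add_distrib]
  refine Finset.sum_le_sum fun x _ => ?_
  exact (congrFun (Set.indicator_union_of_disjoint h fun x => ∏ i, μ (x i)) x).symm.trans_le
    (Set.indicator_le_self' (fun _ _ => Finset.prod_nonneg fun i _ => hμ (x i)) x)

/-- A uniform Chebyshev bound for the relative frequencies. -/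
theorem one_sub_le_iidProb_freq {μ : X → ℝ} (hμ : ∀ a, 0 ≤ μ a) (hsum : ∑ a, μ a = 1)
    {n : ℕ} (hn : 0 < n) {η : ℝ} (hη : 0 < η) :
    1 - Fintype.card X / (n * η ^ 2) ≤ iidProb μ {x : Fin n → X | ∀ a, |freq x a - μ a| ≤ η} := by
  classical
  have hn' : (0 : ℝ) < n := by exact_mod_cast hn
  set G := {x : Fin n → X | ∀ a, |freq x a - μ a| ≤ η} with hG
  let f : X → X → ℝ := fun a b => (if b = a then 1 else 0) - μ a
  have hf : ∀ a, ∑ b, μ b * f a b = 0 := by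
    intro a
    simp [f, mul_sub, Finset.sum_sub_distrib, ← Finset.sum_mul, hsum]
  have hle : ∀ a, μ a ≤ 1 := fun a => hsum ▸ Finset.single_le_sum (fun b _ => hμ b) (by simp)
  have hf2 : ∀ a, ∑ b, μ b * f a b ^ 2 ≤ 1 := by
    intro a
    rw [← hsum]
    refine Finset.sum_le_sum fun b _ => ?_
    have h1 : f a b ^ 2 ≤ 1 := by
      rw [sq_le_one_iff_abs_le_one, abs_le]
      have := hμ a
      have := hle a
      simp only [f]
      split_ifs <;> constructor <;> linarith
    nlinarith [hμ b]
  have hfreq : ∀ (x : Fin n → X) a, ∑ i, f a (x i) = n * (freq x a - μ a) := by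
    intro x a
    simp only [f, freq, Finset.sum_sub_distrib, Finset.sum_const, Finset.card_univ,
      Fintype.card_fin, nsmul_eq_mul, mul_sub]
    field_simp
  -- Markov's inequality and the union bound, pointwise: off `G` some summand's squared deviation
  -- exceeds `(n * η) ^ 2`.
  have hbad : ∀ x : Fin n → X, (∏ i, μ (x i)) - G.indicator (fun x => ∏ i, μ (x i)) x ≤
      ∑ a, (∏ i, μ (x i)) * (∑ i, f a (x i)) ^ 2 / (n * η) ^ 2 := by
    intro x
    have hp : 0 ≤ ∏ i, μ (x i) := Finset.prod_nonneg fun i _ => hμ (x i)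
    have hpos : ∀ a ∈ Finset.univ,
        0 ≤ (∏ i, μ (x i)) * (∑ i, f a (x i)) ^ 2 / (n * η) ^ 2 := fun a _ => by positivity
    by_cases hx : x ∈ G
    · rw [Set.indicator_of_mem hx, sub_self]
      exact Finset.sum_nonneg hpos
    · rw [Set.indicator_of_notMem hx, sub_zero]
      simp only [hG, Set.mem_ofPred_eq, not_forall, not_le] at hx
      obtain ⟨a, ha⟩ := hx
      refine le_trans ?_ (Finset.single_le_sum hpos (Finset.mem_univ a))
      rw [hfreq, mul_div_assoc]
      refine le_mul_of_one_le_right hp ?_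
      rw [one_le_div (by positivity), sq_le_sq, abs_mul, abs_mul, abs_of_pos hη]
      exact mul_le_mul_of_nonneg_left ha.le (abs_nonneg _)
  have hsumbad := Finset.sum_le_sum fun x (_ : x ∈ Finset.univ) => hbad x
  rw [Finset.sum_sub_distrib, sum_prod_eq_one hsum n, Finset.sum_comm] at hsumbad
  have hvar : ∀ a, ∑ x : Fin n → X, (∏ i, μ (x i)) * (∑ i, f a (x i)) ^ 2 / (n * η) ^ 2 ≤
      1 / (n * η ^ 2) := by
    intro a
    rw [← Finset.sum_div, sum_prod_mul_sum_sq hsum (hf a), div_le_div_iff₀ (by positivity)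
      (by positivity)]
    have := hf2 a
    nlinarith [mul_le_mul_of_nonneg_left this (by positivity : 0 ≤ n * (n * η ^ 2))]
  have htotal := Finset.sum_le_sum fun a (_ : a ∈ Finset.univ) => hvar a
  simp only [Finset.sum_const, Finset.card_univ, nsmul_eq_mul] at htotal
  unfold iidProb
  rw [div_eq_mul_one_div]
  linarith

end Sampling

/-! ### Marginals of finite Markov chains -/

section MarkovChain

variable {X : Type*} [Fintype X]

/-- The weight of a path of length `n` under the initial weights `ν` and the kernels `P`. -/
def pathWeight (ν : X → ℝ) (P : ℕ → X → X → ℝ) (n : ℕ) (τ : Fin (n + 1) → X) : ℝ :=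
  ν (τ 0) * ∏ i : Fin n, P i (τ i.castSucc) (τ i.succ)

/-- The marginals of a Markov chain. -/
def chainMarginal (ν : X → ℝ) (P : ℕ → X → X → ℝ) : ℕ → X → ℝ
  | 0, x => ν x
  | k + 1, y => ∑ x, chainMarginal ν P k x * P k x y

variable (ν : X → ℝ) (P : ℕ → X → X → ℝ)

theorem sum_mul_pathWeight_succ (n : ℕ) (g : (Fin (n + 2) → X) → ℝ) :
    ∑ τ, g τ * pathWeight ν P (n + 1) τ = ∑ τ : Fin (n + 1) → X,
      ∑ y, g (Fin.snoc (α := fun _ => X) τ y) * (pathWeight ν P n τ * P n (τ (Fin.last n)) y) := by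
  rw [← (Fin.snocEquiv fun _ : Fin (n + 2) => X).sum_comp, Fintype.sum_prod_type,
    Finset.sum_comm]
  refine Finset.sum_congr rfl fun τ _ => Finset.sum_congr rfl fun y _ => ?_
  simp only [Fin.snocEquiv, Equiv.coe_fn_mk]
  congr 1
  unfold pathWeight
  rw [Fin.prod_univ_castSucc, mul_assoc]
  congr 1
  congr 1
  · refine Finset.prod_congr rfl fun i _ => ?_
    beta_reduce
    rw [Fin.snoc_castSucc, Fin.succ_castSucc, Fin.snoc_castSucc, Fin.val_castSucc]
  · beta_reduce
    rw [Fin.snoc_castSucc, Fin.succ_last, Fin.snoc_last, Fin.val_last]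

theorem sum_last_mul_pathWeight (n : ℕ) (f : X → ℝ) :
    ∑ τ : Fin (n + 1) → X, f (τ (Fin.last n)) * pathWeight ν P n τ =
      ∑ x, f x * chainMarginal ν P n x := by
  induction n generalizing f with
  | zero =>
    rw [← (Equiv.funUnique (Fin 1) X).symm.sum_comp]
    simp [pathWeight, chainMarginal]
  | succ n ih =>
    rw [sum_mul_pathWeight_succ ν P n fun τ => f (τ (Fin.last (n + 1)))]
    simp only [Fin.snoc_last]
    have h : ∀ τ : Fin (n + 1) → X,
        ∑ y, f y * (pathWeight ν P n τ * P n (τ (Fin.last n)) y) =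
          (fun x => ∑ y, f y * P n x y) (τ (Fin.last n)) * pathWeight ν P n τ := by
      intro τ
      rw [Finset.sum_mul]
      exact Finset.sum_congr rfl fun y _ => by ring
    rw [Finset.sum_congr rfl fun τ _ => h τ, ih fun x => ∑ y, f y * P n x y]
    simp only [chainMarginal, Finset.mul_sum, Finset.sum_mul]
    rw [Finset.sum_comm]
    exact Finset.sum_congr rfl fun y _ => Finset.sum_congr rfl fun x _ => by ring

/-- The last coordinate sums out because the rows of `P n` sum to one; iterating this truncates a
path at the time of interest. -/
theorem sum_castSucc_mul_pathWeight (n : ℕ) (hP : ∀ x, ∑ y, P n x y = 1)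
    (g : (Fin (n + 1) → X) → ℝ) :
    ∑ τ : Fin (n + 2) → X, g (fun i => τ i.castSucc) * pathWeight ν P (n + 1) τ =
      ∑ τ, g τ * pathWeight ν P n τ := by
  rw [sum_mul_pathWeight_succ ν P n fun τ => g fun i => τ i.castSucc]
  refine Finset.sum_congr rfl fun τ _ => ?_
  simp only [Fin.snoc_castSucc]
  rw [← Finset.mul_sum, ← Finset.mul_sum, hP, mul_one]

/-- One-dimensional marginals of path weights. -/
theorem sum_apply_mul_pathWeight (n : ℕ) (hP : ∀ i < n, ∀ x, ∑ y, P i x y = 1) (k : ℕ)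
    (hk : k < n + 1) (f : X → ℝ) :
    ∑ τ : Fin (n + 1) → X, f (τ ⟨k, hk⟩) * pathWeight ν P n τ =
      ∑ x, f x * chainMarginal ν P k x := by
  induction n with
  | zero =>
    obtain rfl : k = 0 := by omega
    exact sum_last_mul_pathWeight ν P 0 f
  | succ n ih =>
    rcases (Nat.lt_succ_iff_lt_or_eq.1 hk) with h | rfl
    · rw [← ih (fun i hi => hP i (by omega)) h]
      exact sum_castSucc_mul_pathWeight ν P n (hP n (by omega)) fun τ => f (τ ⟨k, h⟩)
    · exact sum_last_mul_pathWeight ν P (n + 1) f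

/-- Two-dimensional marginals of path weights. -/
theorem sum_apply_apply_mul_pathWeight (n : ℕ) (hP : ∀ i < n, ∀ x, ∑ y, P i x y = 1) (k : ℕ)
    (hk : k + 1 < n + 1) (f : X → X → ℝ) :
    ∑ τ : Fin (n + 1) → X, f (τ ⟨k, by omega⟩) (τ ⟨k + 1, hk⟩) * pathWeight ν P n τ =
      ∑ x, ∑ y, f x y * (chainMarginal ν P k x * P k x y) := by
  induction n with
  | zero => omega
  | succ n ih =>
    rcases (Nat.lt_succ_iff_lt_or_eq.1 hk) with h | h
    · rw [← ih (fun i hi => hP i (by omega)) h]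
      exact sum_castSucc_mul_pathWeight ν P n (hP n (by omega))
        fun τ => f (τ ⟨k, by omega⟩) (τ ⟨k + 1, h⟩)
    · obtain rfl : k = n := by omega
      have h1 := sum_mul_pathWeight_succ ν P k
        fun τ => f (τ (Fin.last k).castSucc) (τ (Fin.last (k + 1)))
      refine h1.trans ?_
      simp only [Fin.snoc_last, Fin.snoc_castSucc]
      have h2 : ∀ τ : Fin (k + 1) → X, ∑ y, f (τ (Fin.last k)) y *
          (pathWeight ν P k τ * P k (τ (Fin.last k)) y) =
            (fun x => ∑ y, f x y * P k x y) (τ (Fin.last k)) * pathWeight ν P k τ := by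
        intro τ
        rw [Finset.sum_mul]
        exact Finset.sum_congr rfl fun y _ => by ring
      rw [Finset.sum_congr rfl fun τ _ => h2 τ,
        sum_last_mul_pathWeight ν P k fun x => ∑ y, f x y * P k x y]
      refine Finset.sum_congr rfl fun x _ => ?_
      rw [Finset.sum_mul]
      exact Finset.sum_congr rfl fun y _ => by ring

end MarkovChain

/-! ### Visit probabilities and their forward recursion -/

section Visits

variable {S A : Type*} [Fintype S] [Fintype A] {H : ℕ}

/-- The transition kernel on state-action pairs. -/
noncomputable def saKernel (p : Transition S A H) (π : Policy S A H) (k : ℕ) (x y : S × A) : ℝ :=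
  if hk : k + 1 < H then p ⟨k, by omega⟩ x.1 x.2 y.1 * π ⟨k + 1, hk⟩ y.1 y.2 else 0

theorem sum_saKernel (p : Transition S A H) (π : Policy S A H) {k : ℕ} (hk : k + 1 < H)
    (x : S × A) : ∑ y, saKernel p π k x y = 1 := by
  simp only [saKernel, dif_pos hk, Fintype.sum_prod_type, ← Finset.mul_sum,
    stdSimplex.sum_eq_one, mul_one]

/-- `trajProb` groups each action with the transition that follows it, the kernel each transition
with the next action. The shift moves the first action into the initial weights; the last stage
contributes no transition factor. -/
theorem trajProb_eq_pathWeight {n : ℕ} (μ₀ : stdSimplex ℝ S) (p : Transition S A (n + 1))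
    (π : Policy S A (n + 1)) (τ : Traj S A (n + 1)) :
    trajProb μ₀ p π τ =
      pathWeight (fun x : S × A => μ₀ x.1 * π 0 x.1 x.2) (saKernel p π) n τ := by
  unfold trajProb pathWeight
  rw [Finset.prod_mul_distrib, Fin.prod_univ_succ, mul_assoc, mul_assoc]
  congr 2
  rw [Fin.prod_univ_castSucc, mul_comm]
  simp only [Fin.val_last, lt_self_iff_false, dite_false, mul_one]
  rw [← Finset.prod_mul_distrib]
  refine Finset.prod_congr rfl fun i _ => ?_
  have hi : i.val + 1 < n + 1 := by omega
  simp only [saKernel, Fin.val_castSucc, dif_pos hi]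
  rfl

variable [NeZero H] (μ₀ : stdSimplex ℝ S) (p : Transition S A H) (π : Policy S A H)

theorem sum_apply_mul_trajProb (h : Fin H) (f : S × A → ℝ) :
    ∑ τ : Traj S A H, f (τ h) * trajProb μ₀ p π τ =
      ∑ x, f x * chainMarginal (fun x : S × A => μ₀ x.1 * π 0 x.1 x.2) (saKernel p π) h x := by
  obtain _ | n := H
  · exact h.elim0
  simp only [trajProb_eq_pathWeight]
  exact sum_apply_mul_pathWeight _ _ n (fun i hi => sum_saKernel p π (by omega)) h h.2 f

theorem visitSA_eq_chainMarginal (h : Fin H) (s : S) (a : A) :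
    visitSA μ₀ p π h s a =
      chainMarginal (fun x : S × A => μ₀ x.1 * π 0 x.1 x.2) (saKernel p π) h (s, a) := by
  classical
  have := sum_apply_mul_trajProb μ₀ p π h fun x => if x = (s, a) then 1 else 0
  simp only [ite_mul, one_mul, zero_mul, Finset.sum_ite_eq', Finset.mem_univ, if_true] at this
  rw [← this, visitSA]

theorem visitSA_zero (s : S) (a : A) : visitSA μ₀ p π 0 s a = μ₀ s * π 0 s a := by
  rw [visitSA_eq_chainMarginal]
  simp [chainMarginal]

theorem visitSA_succ (h : Fin H) (hh : h.val + 1 < H) (s' : S) (a' : A) :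
    visitSA μ₀ p π ⟨h.val + 1, hh⟩ s' a' =
      (∑ s, ∑ a, visitSA μ₀ p π h s a * p h s a s') * π ⟨h.val + 1, hh⟩ s' a' := by
  simp only [visitSA_eq_chainMarginal, chainMarginal, Fintype.sum_prod_type, saKernel, dif_pos hh,
    Finset.sum_mul, mul_assoc]

theorem visitS_zero (s : S) : visitS μ₀ p π 0 s = μ₀ s := by
  simp only [visitS, visitSA_zero, ← Finset.mul_sum, stdSimplex.sum_eq_one, mul_one]

theorem visitS_succ (h : Fin H) (hh : h.val + 1 < H) (s' : S) :
    visitS μ₀ p π ⟨h.val + 1, hh⟩ s' = ∑ s, ∑ a, visitSA μ₀ p π h s a * p h s a s' := by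
  simp only [visitS, visitSA_succ, ← Finset.mul_sum, stdSimplex.sum_eq_one, mul_one]

/-- Induction on the stage. -/
theorem stage_induction {motive : Fin H → Prop} (zero : motive 0)
    (succ : ∀ (h : Fin H) (hh : h.val + 1 < H), motive h → motive ⟨h.val + 1, hh⟩) (h : Fin H) :
    motive h := by
  obtain ⟨k, hk⟩ := h
  induction k with
  | zero => exact zero
  | succ k ih => exact succ ⟨k, by omega⟩ hk (ih (by omega))

theorem visitSA_eq_visitS_mul (h : Fin H) (s : S) (a : A) :
    visitSA μ₀ p π h s a = visitS μ₀ p π h s * π h s a := by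
  revert s a
  induction h using stage_induction with
  | zero => intro s a; rw [visitSA_zero, visitS_zero]
  | succ h hh _ => intro s a; rw [visitSA_succ, visitS_succ]

theorem trajProb_nonneg (τ : Traj S A H) : 0 ≤ trajProb μ₀ p π τ := by
  refine mul_nonneg (μ₀.2.1 _) (Finset.prod_nonneg fun h _ => mul_nonneg ((π _ _).2.1 _) ?_)
  split_ifs
  · exact (p _ _ _).2.1 _
  · exact zero_le_one

theorem sum_trajProb : ∑ τ : Traj S A H, trajProb μ₀ p π τ = 1 := by
  have h1 := sum_apply_mul_trajProb μ₀ p π 0 fun _ => 1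
  simp only [one_mul] at h1
  rw [h1]
  simp [chainMarginal, Fintype.sum_prod_type, ← Finset.mul_sum]

theorem visitSA_nonneg (h : Fin H) (s : S) (a : A) : 0 ≤ visitSA μ₀ p π h s a :=
  Finset.sum_nonneg fun τ _ => by
    split_ifs
    exacts [trajProb_nonneg μ₀ p π τ, le_rfl]

theorem visitS_nonneg (h : Fin H) (s : S) : 0 ≤ visitS μ₀ p π h s :=
  Finset.sum_nonneg fun a _ => visitSA_nonneg μ₀ p π h s a

theorem visitSA_pos_iff {h : Fin H} {s : S} {a : A} :
    0 < visitSA μ₀ p π h s a ↔ ∃ τ : Traj S A H, τ h = (s, a) ∧ 0 < trajProb μ₀ p π τ := by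
  rw [visitSA, Finset.sum_pos_iff_of_nonneg]
  · refine exists_congr fun τ => ?_
    by_cases hτ : τ h = (s, a) <;> simp [hτ]
  · intro τ _
    split_ifs
    exacts [trajProb_nonneg μ₀ p π τ, le_rfl]

theorem visitSA_pos_iff_visitS {h : Fin H} {s : S} {a : A} :
    0 < visitSA μ₀ p π h s a ↔ 0 < visitS μ₀ p π h s ∧ 0 < π h s a := by
  rw [visitSA_eq_visitS_mul]
  constructor
  · intro h'
    exact ⟨pos_of_mul_pos_left h' ((π h s).2.1 a),
      pos_of_mul_pos_right h' (visitS_nonneg μ₀ p π h s)⟩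
  · rintro ⟨h1, h2⟩
    exact mul_pos h1 h2

open Classical in
/-- The probability of a transition `(s, a) → s'` at a given stage. -/
theorem sum_ite_trajProb (h : Fin H) (hh : h.val + 1 < H) (s : S) (a : A) (s' : S) :
    ∑ τ : Traj S A H, (if τ h = (s, a) ∧ (τ ⟨h.val + 1, hh⟩).1 = s' then trajProb μ₀ p π τ else 0) =
      visitSA μ₀ p π h s a * p h s a s' := by
  rw [visitSA_eq_chainMarginal]
  obtain _ | n := H
  · exact h.elim0
  simp only [trajProb_eq_pathWeight]
  have := sum_apply_apply_mul_pathWeight (fun x : S × A => μ₀ x.1 * π 0 x.1 x.2) (saKernel p π)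
    n (fun i hi => sum_saKernel p π (by omega)) h hh
    fun x y => if x = (s, a) ∧ y.1 = s' then 1 else 0
  simp only [Fin.eta, ite_mul, one_mul, zero_mul] at this
  rw [this]
  have hn : h.val < n := by omega
  simp only [ite_and, Fintype.sum_prod_type (f := fun y : S × A => ite _ _ _)]
  simp [saKernel, hn, Finset.sum_ite_eq', ← Finset.mul_sum]

end Visits

/-! ### A topological criterion for learnability -/

section Criterion

variable {S A : Type*} [Fintype S] [Fintype A] {H : ℕ} [NeZero H]

open Filter Topology in
/-- A set-valued map is learnable when its values are closed and, locally in the law of the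
trajectories with a given support, miss the compact sets which the value misses. -/
theorem pacLearnable_of_locally_disjoint {C : Set (Instance S A H)}
    {φ : Instance S A H → Set (Reward S A H)} (hclosed : ∀ I ∈ C, IsClosed (φ I))
    (hloc : ∀ I ∈ C, ∀ K, IsCompact K → Disjoint (φ I) K → ∃ η > 0, ∀ I' ∈ C,
      (∀ τ, 0 < I'.law τ ↔ 0 < I.law τ) → (∀ τ, |I'.law τ - I.law τ| ≤ η) → Disjoint (φ I') K) :
    PACLearnable C φ := by
  obtain ⟨d, hd, hdK⟩ := exists_relaxedSemimetric (Reward S A H)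
  -- The rate `n ^ (-1/4)` tends to zero, yet slowly enough that `n * rate n ^ 2 = √n` makes the
  -- Chebyshev error vanish.
  let rate : ℕ → ℝ := fun n => (√(√n))⁻¹
  have hrate : Tendsto rate atTop (𝓝 0) :=
    ((Real.tendsto_sqrt_atTop.comp Real.tendsto_sqrt_atTop).comp
      tendsto_natCast_atTop_atTop).inv_tendsto_atTop
  have hrate_sq : ∀ n : ℕ, (n : ℝ) * rate n ^ 2 = √n := by
    intro n
    simp only [rate, inv_pow, Real.sq_sqrt (Real.sqrt_nonneg _), ← div_eq_mul_inv, Real.div_sqrt]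
  -- Compatible instances must match the frequencies and have as support the trajectories of
  -- frequency above `rate n`.
  let conf : (n : ℕ) → (Fin n → Traj S A H) → Set (Instance S A H) := fun n x =>
    {I ∈ C | ∀ τ, |freq x τ - I.law τ| ≤ rate n ∧ (0 < I.law τ ↔ rate n < freq x τ)}
  refine ⟨d, hd, fun n x => closure (⋃ I ∈ conf n x, φ I), fun I hI ε hε δ hδ => ?_⟩
  obtain ⟨K, hK, hIK, hKd⟩ := hdK (φ I) (hclosed I hI) ε hε.1
  -- The output is a closure, so the union must miss a neighbourhood of `K`; the closed thickening
  -- is still compact.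
  obtain ⟨t, ht, hdisj⟩ := hIK.symm.exists_cthickenings hK (hclosed I hI)
  obtain ⟨η, hη, hηK⟩ := hloc I hI _ hK.cthickening
    (hdisj.symm.mono_left (Metric.self_subset_cthickening _))
  -- Once every positive probability exceeds `2 * rate n`, thresholding frequencies at `rate n`
  -- recovers the support exactly on the good event.
  have hsmall : ∀ᶠ n in atTop, ∀ τ, 0 < I.law τ → 2 * rate n < I.law τ := by
    rw [eventually_all]
    intro τ
    by_cases hτ : 0 < I.law τ
    · have h2 : Tendsto (fun n => 2 * rate n) atTop (𝓝 0) := by simpa using hrate.const_mul 2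
      filter_upwards [h2.eventually_lt_const hτ] with n hn _ using hn
    · simp [hτ]
  have hη' : ∀ᶠ n in atTop, 2 * rate n ≤ η := by
    have h2 : Tendsto (fun n => 2 * rate n) atTop (𝓝 0) := by simpa using hrate.const_mul 2
    exact h2.eventually_le_const hη
  have hcard : ∀ᶠ n : ℕ in atTop, (Fintype.card (Traj S A H) : ℝ) / √n ≤ δ := by
    have h2 : Tendsto (fun n : ℕ => (Fintype.card (Traj S A H) : ℝ) / √n) atTop (𝓝 0) :=
      (Real.tendsto_sqrt_atTop.comp tendsto_natCast_atTop_atTop).const_div_atTop _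
    exact h2.eventually_le_const hδ.1
  obtain ⟨N, hN⟩ := eventually_atTop.1
    (hsmall.and (hη'.and (hcard.and (eventually_gt_atTop 0))))
  refine ⟨N, fun n hn => ?_⟩
  obtain ⟨hs, hη2, hc, hn0⟩ := hN n hn
  have hrate_pos : 0 < rate n := by
    have : (0 : ℝ) < n := by exact_mod_cast hn0
    positivity
  have hlaw : ∀ τ, 0 ≤ I.law τ := trajProb_nonneg I.init I.trans I.behavior
  have hcheb := one_sub_le_iidProb_freq hlaw (sum_trajProb I.init I.trans I.behavior) hn0 hrate_pos
  rw [hrate_sq] at hcheb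
  refine (by linarith : 1 - δ ≤ _).trans (hcheb.trans (iidProb_mono hlaw fun x hx => ?_))
  rw [Set.mem_ofPred_eq] at hx
  have hIconf : I ∈ conf n x := by
    refine ⟨hI, fun τ => ⟨hx τ, fun h => ?_, fun h => ?_⟩⟩
    · have h1 := hs τ h
      have h2 := (abs_le.1 (hx τ)).1
      linarith
    · have h2 := (abs_le.1 (hx τ)).2
      linarith
  refine hKd _ isClosed_closure ((Set.subset_biUnion_of_mem hIconf).trans subset_closure) ?_
  -- Being compatible with the same sample, `I'` and `I` have equal supports and laws within `2 *
  -- rate n ≤ η`.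
  have hmiss : Disjoint (⋃ I' ∈ conf n x, φ I') (Metric.cthickening t K) := by
    refine Set.disjoint_iUnion₂_left.2 fun I' hI' => hηK I' hI'.1 (fun τ => ?_) fun τ => ?_
    · rw [(hI'.2 τ).2, (hIconf.2 τ).2]
    · have h1 := abs_le.1 (hI'.2 τ).1
      have h2 := abs_le.1 (hx τ)
      rw [abs_le]
      constructor <;> linarith
  exact ((hmiss.mono_right (Metric.thickening_subset_cthickening t K)).closure_left
    Metric.isOpen_thickening).mono_right (Metric.self_subset_thickening ht K)

end Criterion

/-! ### Continuity of Q-functions, utilities and trajectory laws -/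

section Continuity

variable {T S A : Type*} [TopologicalSpace T] [Fintype S] [Fintype A] {H : ℕ}

theorem continuous_stdSimplex_apply {X : Type*} [Fintype X] {μ : T → stdSimplex ℝ X}
    (hμ : Continuous μ) (x : X) : Continuous fun t => μ t x :=
  (continuous_apply x).comp (continuous_subtype_val.comp hμ)

variable {μ₀ : T → stdSimplex ℝ S} {p : T → Transition S A H} {π : T → Policy S A H}
  {r : T → Reward S A H}

theorem continuous_transition_apply (hp : Continuous p) (h : Fin H) (s : S) (a : A) (s' : S) :
    Continuous fun t => p t h s a s' :=
  continuous_stdSimplex_apply (μ := fun t => p t h s a) (by fun_prop) s'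

theorem continuous_policy_apply (hπ : Continuous π) (h : Fin H) (s : S) (a : A) :
    Continuous fun t => π t h s a :=
  continuous_stdSimplex_apply (μ := fun t => π t h s) (by fun_prop) a

theorem continuous_qFun (hp : Continuous p) (hπ : Continuous π) (hr : Continuous r)
    (h : Fin H) (s : S) (a : A) :
    Continuous fun t => qFun (p t) (π t) (r t) h s a := by
  induction hk : H - h.val generalizing h s a with
  | zero => omega
  | succ k ih =>
    have hr' : Continuous fun t => r t h s a := by fun_prop
    by_cases hh : h.val + 1 < H
    · have heq : (fun t => qFun (p t) (π t) (r t) h s a) = fun t => r t h s a +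
          ∑ s' : S, p t h s a s' * ∑ a' : A, π t ⟨h.val + 1, hh⟩ s' a' *
            qFun (p t) (π t) (r t) ⟨h.val + 1, hh⟩ s' a' := by
        funext t
        rw [qFun, dif_pos hh]
      rw [heq]
      refine hr'.add (continuous_finsetSum _ fun s' _ => ?_)
      refine (continuous_transition_apply hp _ _ _ _).mul (continuous_finsetSum _ fun a' _ => ?_)
      exact (continuous_policy_apply hπ _ _ _).mul (ih ⟨h.val + 1, hh⟩ s' a' (by simp; omega))
    · have heq : (fun t => qFun (p t) (π t) (r t) h s a) = fun t => r t h s a := by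
        funext t
        rw [qFun, dif_neg hh, add_zero]
      rwa [heq]

theorem isClosed_mem_oldFeasibleSet (hp : Continuous p) (hπ : Continuous π) (hr : Continuous r) :
    IsClosed {t | r t ∈ oldFeasibleSet (p t) (π t)} := by
  change IsClosed {t | ∀ h s a, qFun (p t) (π t) (r t) h s a ≤
    ∑ a', π t h s a' * qFun (p t) (π t) (r t) h s a'}
  simp only [Set.ofPred_forall]
  refine isClosed_iInter fun h => isClosed_iInter fun s => isClosed_iInter fun a =>
    isClosed_le (continuous_qFun hp hπ hr _ _ _) (continuous_finsetSum _ fun a' _ => ?_)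
  exact (continuous_policy_apply hπ _ _ _).mul (continuous_qFun hp hπ hr _ _ _)

variable [NeZero H]

theorem continuous_utility (hμ : Continuous μ₀) (hp : Continuous p) (hπ : Continuous π)
    (hr : Continuous r) : Continuous fun t => utility (μ₀ t) (p t) (π t) (r t) :=
  continuous_finsetSum _ fun s _ => (continuous_stdSimplex_apply hμ s).mul
    (continuous_finsetSum _ fun a _ =>
      (continuous_policy_apply hπ _ _ _).mul (continuous_qFun hp hπ hr _ _ _))

theorem continuous_trajProb (hμ : Continuous μ₀) (hp : Continuous p) (hπ : Continuous π)
    (τ : Traj S A H) : Continuous fun t => trajProb (μ₀ t) (p t) (π t) τ := by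
  refine (continuous_stdSimplex_apply hμ _).mul (continuous_finsetProd _ fun h _ =>
    (continuous_policy_apply hπ _ _ _).mul ?_)
  split_ifs
  · exact continuous_transition_apply hp _ _ _ _
  · exact continuous_const

theorem mem_feasibleSet_iff {μ₀ : stdSimplex ℝ S} {p : Transition S A H} {π : Policy S A H}
    {r : Reward S A H} :
    r ∈ feasibleSet μ₀ p π ↔ ∀ π', utility μ₀ p π' r ≤ utility μ₀ p π r := by
  simp [feasibleSet, IsGreatest, mem_upperBounds]

theorem isClosed_mem_feasibleSet (hμ : Continuous μ₀) (hp : Continuous p) (hπ : Continuous π)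
    (hr : Continuous r) : IsClosed {t | r t ∈ feasibleSet (μ₀ t) (p t) (π t)} := by
  simp only [mem_feasibleSet_iff, Set.ofPred_forall]
  exact isClosed_iInter fun π' => isClosed_le (continuous_utility hμ hp continuous_const hr)
    (continuous_utility hμ hp hπ hr)

end Continuity

/-! ### Closed graphs of the reward sets -/

section ClosedGraph

variable {S A : Type*} [Fintype S] [Fintype A] {H : ℕ}

/-- The graph of a set of rewards depending on an initial distribution and a transition model. -/
def rewardGraph (Ψ : stdSimplex ℝ S → Transition S A H → Set (Reward S A H)) :
    Set (stdSimplex ℝ S × Transition S A H × Reward S A H) :=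
  {x | x.2.2 ∈ Ψ x.1 x.2.1}

theorem isClosed_transClass (Z : Set (S × A × Fin H)) :
    IsClosed {x : Transition S A H × Transition S A H | x.2 ∈ transClass Z x.1} := by
  change IsClosed {x : Transition S A H × Transition S A H |
    ∀ z ∈ Z, x.1 z.2.2 z.1 z.2.1 = x.2 z.2.2 z.1 z.2.1}
  simp only [Set.ofPred_forall]
  exact isClosed_iInter fun z => isClosed_iInter fun _ =>
    isClosed_eq (by fun_prop) (by fun_prop)

open Classical in
/-- The transition model which follows `p` on `Z` and `q` elsewhere. -/
noncomputable def mergeTrans (Z : Set (S × A × Fin H)) (p q : Transition S A H) :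
    Transition S A H :=
  fun h s a => if (s, a, h) ∈ Z then p h s a else q h s a

theorem mergeTrans_mem_transClass (Z : Set (S × A × Fin H)) (p q : Transition S A H) :
    mergeTrans Z p q ∈ transClass Z p := by
  rintro ⟨s, a, h⟩ hx
  simp only [mergeTrans, if_pos hx]

theorem mergeTrans_eq_of_mem {Z : Set (S × A × Fin H)} {p q : Transition S A H}
    (hq : q ∈ transClass Z p) : mergeTrans Z p q = q := by
  funext h s a
  unfold mergeTrans
  split_ifs with hx
  · exact hq _ hx
  · rfl

theorem continuous_mergeTrans (Z : Set (S × A × Fin H)) (q : Transition S A H) :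
    Continuous fun p : Transition S A H => mergeTrans Z p q := by
  refine continuous_pi fun h => continuous_pi fun s => continuous_pi fun a => ?_
  unfold mergeTrans
  split_ifs
  · fun_prop
  · exact continuous_const

/-- The class of `p` is the image of all models `q` under `mergeTrans Z p`, so the index set no
longer varies with `p` and the graph is an intersection of closed preimages. -/
theorem isClosed_rewardGraph_iInter_transClass (Z : Set (S × A × Fin H))
    {Ψ : stdSimplex ℝ S → Transition S A H → Set (Reward S A H)} (hΨ : IsClosed (rewardGraph Ψ)) :
    IsClosed (rewardGraph fun μ₀ p => ⋂ p' ∈ transClass Z p, Ψ μ₀ p') := by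
  have heq : rewardGraph (fun μ₀ p => ⋂ p' ∈ transClass Z p, Ψ μ₀ p') =
      ⋂ q, (fun x => (x.1, mergeTrans Z x.2.1 q, x.2.2)) ⁻¹' rewardGraph Ψ := by
    ext ⟨μ₀, p, r⟩
    simp only [rewardGraph, Set.mem_ofPred_eq, Set.mem_iInter, Set.mem_preimage]
    refine ⟨fun h q => h _ (mergeTrans_mem_transClass Z p q), fun h q hq => ?_⟩
    rw [← mergeTrans_eq_of_mem hq]
    exact h q
  rw [heq]
  refine isClosed_iInter fun q => hΨ.preimage ?_
  exact continuous_fst.prodMk (((continuous_mergeTrans Z q).comp (by fun_prop)).prodMk (by fun_prop))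

/-- The graph is the projection of a closed set along the compact space of transition models. -/
theorem isClosed_rewardGraph_iUnion_transClass (Z : Set (S × A × Fin H))
    {Ψ : stdSimplex ℝ S → Transition S A H → Set (Reward S A H)} (hΨ : IsClosed (rewardGraph Ψ)) :
    IsClosed (rewardGraph fun μ₀ p => ⋃ p' ∈ transClass Z p, Ψ μ₀ p') := by
  have heq : rewardGraph (fun μ₀ p => ⋃ p' ∈ transClass Z p, Ψ μ₀ p') =
      Prod.fst '' ({y : (stdSimplex ℝ S × Transition S A H × Reward S A H) × Transition S A H |
        y.2 ∈ transClass Z y.1.2.1 ∧ (y.1.1, y.2, y.1.2.2) ∈ rewardGraph Ψ}) := by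
    ext ⟨μ₀, p, r⟩
    simp [rewardGraph]
  rw [heq]
  refine isClosedMap_fst_of_compactSpace _ (IsClosed.inter ?_ ?_)
  · exact (isClosed_transClass Z).preimage
      (f := fun y : (stdSimplex ℝ S × Transition S A H × Reward S A H) × Transition S A H =>
        (y.1.2.1, y.2)) (by fun_prop)
  · exact hΨ.preimage
      (f := fun y : (stdSimplex ℝ S × Transition S A H × Reward S A H) × Transition S A H =>
        (y.1.1, y.2, y.1.2.2)) (by fun_prop)

theorem isClosed_policyClass (Z : Set (S × Fin H)) (π : Policy S A H) :
    IsClosed (policyClass Z π) := by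
  simp only [policyClass, Set.ofPred_forall]
  exact isClosed_iInter fun z => isClosed_iInter fun _ =>
    isClosed_eq (by fun_prop) (by fun_prop)

theorem isClosed_rewardGraph_iInter_policyClass (Z : Set (S × Fin H)) (π : Policy S A H) :
    IsClosed (rewardGraph fun (_ : stdSimplex ℝ S) (p : Transition S A H) =>
      ⋂ π' ∈ policyClass Z π, oldFeasibleSet p π') := by
  simp only [rewardGraph, Set.mem_iInter, Set.ofPred_forall]
  exact isClosed_iInter fun π' => isClosed_iInter fun _ =>
    isClosed_mem_oldFeasibleSet (by fun_prop) continuous_const (by fun_prop)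

theorem isClosed_rewardGraph_iUnion_policyClass (Z : Set (S × Fin H)) (π : Policy S A H) :
    IsClosed (rewardGraph fun (_ : stdSimplex ℝ S) (p : Transition S A H) =>
      ⋃ π' ∈ policyClass Z π, oldFeasibleSet p π') := by
  have heq : rewardGraph (fun (_ : stdSimplex ℝ S) (p : Transition S A H) =>
      ⋃ π' ∈ policyClass Z π, oldFeasibleSet p π') =
      Prod.fst '' ({y : (stdSimplex ℝ S × Transition S A H × Reward S A H) × Policy S A H |
        y.2 ∈ policyClass Z π ∧ y.1.2.2 ∈ oldFeasibleSet y.1.2.1 y.2}) := by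
    ext ⟨μ₀, p, r⟩
    simp [rewardGraph]
  rw [heq]
  exact isClosedMap_fst_of_compactSpace _ (((isClosed_policyClass Z π).preimage
    continuous_snd).inter
      (isClosed_mem_oldFeasibleSet (by fun_prop) (by fun_prop) (by fun_prop)))

variable [NeZero H]

theorem isClosed_rewardGraph_feasibleSet (π : Policy S A H) :
    IsClosed (rewardGraph fun (μ₀ : stdSimplex ℝ S) (p : Transition S A H) =>
      feasibleSet μ₀ p π) :=
  isClosed_mem_feasibleSet (by fun_prop) (by fun_prop) continuous_const (by fun_prop)

end ClosedGraph

/-! ### Learnability of the four sets -/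

section LearnableOfClosedGraph

variable {S A : Type*} [Fintype S] [Fintype A] {H : ℕ} [NeZero H]

theorem suppSA_eq_of_law_pos_iff {μ μ' : stdSimplex ℝ S} {p p' : Transition S A H}
    {π π' : Policy S A H} (h : ∀ τ, 0 < trajProb μ p π τ ↔ 0 < trajProb μ' p' π' τ) :
    suppSA μ p π = suppSA μ' p' π' := by
  ext x
  simp only [suppSA, Set.mem_ofPred_eq, visitSA_pos_iff, h]

theorem visitSA_eq_of_trajProb_eq {μ μ' : stdSimplex ℝ S} {p p' : Transition S A H}
    {π π' : Policy S A H} (h : ∀ τ, trajProb μ p π τ = trajProb μ' p' π' τ) (k : Fin H) (s : S)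
    (a : A) : visitSA μ p π k s a = visitSA μ' p' π' k s a := by
  simp only [visitSA, h]

/-- The law of the trajectories determines the initial distribution. -/
theorem init_eq_of_trajProb_eq {μ μ' : stdSimplex ℝ S} {p p' : Transition S A H}
    {π π' : Policy S A H} (h : ∀ τ, trajProb μ p π τ = trajProb μ' p' π' τ) : μ = μ' := by
  refine DFunLike.ext _ _ fun s => ?_
  rw [← visitS_zero μ p π, ← visitS_zero μ' p' π']
  simp only [visitS, visitSA_eq_of_trajProb_eq h]

/-- The law of the trajectories determines the transitions from the visited pairs to the later
stages. -/
theorem trans_eq_of_trajProb_eq {μ μ' : stdSimplex ℝ S} {p p' : Transition S A H}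
    {π π' : Policy S A H} (h : ∀ τ, trajProb μ p π τ = trajProb μ' p' π' τ) {k : Fin H}
    (hk : k.val + 1 < H) {s : S} {a : A} (hpos : 0 < visitSA μ p π k s a) :
    p k s a = p' k s a := by
  classical
  refine DFunLike.ext _ _ fun s' => mul_left_cancel₀ hpos.ne' ?_
  rw [← sum_ite_trajProb _ _ _ _ hk, visitSA_eq_of_trajProb_eq h, ← sum_ite_trajProb _ _ _ _ hk]
  simp only [h]

/-- A set of rewards is learnable when it depends on the visited part of the MDP with a closed
graph. -/
theorem pacLearnable_of_isClosed_rewardGraph {C : Set (Instance S A H)}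
    {φ : Instance S A H → Set (Reward S A H)}
    (Φ : Set (S × A × Fin H) → stdSimplex ℝ S → Transition S A H → Set (Reward S A H))
    (hφ : ∀ I ∈ C, φ I = Φ I.behaviorSupp I.init I.trans)
    (hclosed : ∀ Z, IsClosed (rewardGraph (Φ Z)))
    (hcongr : ∀ Z μ₀ p p', (∀ x ∈ Z, x.2.2.val + 1 < H → p x.2.2 x.1 x.2.1 = p' x.2.2 x.1 x.2.1) →
      Φ Z μ₀ p = Φ Z μ₀ p') :
    PACLearnable C φ := by
  refine pacLearnable_of_locally_disjoint (fun I hI => ?_) fun I hI K hK hdisj => ?_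
  · rw [hφ I hI]
    exact (hclosed I.behaviorSupp).preimage
      (f := fun r : Reward S A H => (I.init, I.trans, r)) (by fun_prop)
  · let L : (stdSimplex ℝ S × Transition S A H × Policy S A H) × Reward S A H →
        Traj S A H → ℝ := fun x τ => trajProb x.1.1 x.1.2.1 x.1.2.2 τ
    have hL : Continuous L := continuous_pi fun τ =>
      continuous_trajProb (by fun_prop) (by fun_prop) (by fun_prop) τ
    -- All data and rewards in `K` that would violate disjointness, with the support frozen at that
    -- of `I`. The set is compact, so the laws it produces form a closed set; the law of `I` is not
    -- among them, which yields the radius.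
    let B : Set ((stdSimplex ℝ S × Transition S A H × Policy S A H) × Reward S A H) :=
      (Set.univ ×ˢ K) ∩ (fun x => (x.1.1, x.1.2.1, x.2)) ⁻¹' rewardGraph (Φ I.behaviorSupp)
    have hB : IsCompact B := (isCompact_univ.prod hK).inter_right
      ((hclosed I.behaviorSupp).preimage (by fun_prop))
    have hnot : I.law ∉ L '' B := by
      rintro ⟨⟨⟨μ, p, π⟩, r⟩, ⟨⟨-, hrK⟩, hr⟩, hlaw⟩
      have htraj : ∀ τ, trajProb I.init I.trans I.behavior τ = trajProb μ p π τ :=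
        fun τ => (congrFun hlaw τ).symm
      refine Set.disjoint_left.1 hdisj ?_ hrK
      rw [hφ I hI, init_eq_of_trajProb_eq htraj,
        hcongr I.behaviorSupp μ I.trans p fun x hx hk => trans_eq_of_trajProb_eq htraj hk hx]
      exact hr
    obtain ⟨ε, hε, hball⟩ := Metric.isOpen_iff.1 (hB.image hL).isClosed.isOpen_compl _ hnot
    refine ⟨ε / 2, half_pos hε, fun I' hI' hpos hclose => Set.disjoint_left.2 fun r hr hrK => ?_⟩
    have hmem : I'.law ∈ Metric.ball I.law ε := by
      rw [Metric.mem_ball]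
      exact ((dist_pi_le_iff (half_pos hε).le).2 fun τ => hclose τ).trans_lt (half_lt_self hε)
    refine hball hmem ⟨((I'.init, I'.trans, I'.behavior), r), ⟨⟨Set.mem_univ _, hrK⟩, ?_⟩, rfl⟩
    have hsupp : I'.behaviorSupp = I.behaviorSupp := suppSA_eq_of_law_pos_iff hpos
    rw [hφ I' hI', hsupp] at hr
    exact hr

open Classical in
/-- The transition model `q` with the transitions of the last stage replaced by those of `p`. -/
noncomputable def replaceLast (q p : Transition S A H) : Transition S A H :=
  fun h => if h.val + 1 < H then q h else p h

/-- Last-stage transitions affect neither the law nor any Q-function, yet `transClass` constrains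
them. Replacing them passes from one class to the other at no cost. -/
theorem exists_mem_transClass {Z : Set (S × A × Fin H)} {p p' q : Transition S A H}
    (h : ∀ x ∈ Z, x.2.2.val + 1 < H → p x.2.2 x.1 x.2.1 = p' x.2.2 x.1 x.2.1)
    (hq : q ∈ transClass Z p) :
    ∃ q' ∈ transClass Z p', ∀ k : Fin H, k.val + 1 < H → q k = q' k := by
  refine ⟨replaceLast q p', fun x hx => ?_, fun k hk => ?_⟩
  · unfold replaceLast
    split_ifs with hk
    · rw [← h x hx hk, hq x hx]
    · rfl
  · simp only [replaceLast, if_pos hk]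

variable {Z : Set (S × A × Fin H)} {p p' : Transition S A H}
  {Ψ : Transition S A H → Set (Reward S A H)}

theorem iInter_transClass_congr
    (hΨ : ∀ q q', (∀ k : Fin H, k.val + 1 < H → q k = q' k) → Ψ q = Ψ q')
    (h : ∀ x ∈ Z, x.2.2.val + 1 < H → p x.2.2 x.1 x.2.1 = p' x.2.2 x.1 x.2.1) :
    ⋂ q ∈ transClass Z p, Ψ q = ⋂ q ∈ transClass Z p', Ψ q := by
  refine Set.Subset.antisymm (Set.subset_iInter₂ fun q hq => ?_)
    (Set.subset_iInter₂ fun q hq => ?_)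
  · obtain ⟨q', hq', hqq⟩ := exists_mem_transClass (fun x hx hk => (h x hx hk).symm) hq
    rw [hΨ q q' hqq]
    exact Set.biInter_subset_of_mem hq'
  · obtain ⟨q', hq', hqq⟩ := exists_mem_transClass h hq
    rw [hΨ q q' hqq]
    exact Set.biInter_subset_of_mem hq'

theorem iUnion_transClass_congr
    (hΨ : ∀ q q', (∀ k : Fin H, k.val + 1 < H → q k = q' k) → Ψ q = Ψ q')
    (h : ∀ x ∈ Z, x.2.2.val + 1 < H → p x.2.2 x.1 x.2.1 = p' x.2.2 x.1 x.2.1) :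
    ⋃ q ∈ transClass Z p, Ψ q = ⋃ q ∈ transClass Z p', Ψ q := by
  refine Set.Subset.antisymm (Set.iUnion₂_subset fun q hq => ?_)
    (Set.iUnion₂_subset fun q hq => ?_)
  · obtain ⟨q', hq', hqq⟩ := exists_mem_transClass h hq
    rw [hΨ q q' hqq]
    exact Set.subset_biUnion_of_mem hq'
  · obtain ⟨q', hq', hqq⟩ := exists_mem_transClass (fun x hx hk => (h x hx hk).symm) hq
    rw [hΨ q q' hqq]
    exact Set.subset_biUnion_of_mem hq'

theorem qFun_congr_trans {p p' : Transition S A H} (h : ∀ k : Fin H, k.val + 1 < H → p k = p' k)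
    (π : Policy S A H) (r : Reward S A H) (k : Fin H) (s : S) (a : A) :
    qFun p π r k s a = qFun p' π r k s a := by
  induction hn : H - k.val generalizing k s a with
  | zero => omega
  | succ n ih =>
    rw [qFun, qFun]
    by_cases hk : k.val + 1 < H
    · rw [dif_pos hk, dif_pos hk, h k hk]
      congr 1
      refine Finset.sum_congr rfl fun s' _ => ?_
      congr 1
      refine Finset.sum_congr rfl fun a' _ => ?_
      rw [ih ⟨k.val + 1, hk⟩ s' a' (by simp; omega)]
    · rw [dif_neg hk, dif_neg hk]

theorem oldFeasibleSet_congr_trans {p p' : Transition S A H}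
    (h : ∀ k : Fin H, k.val + 1 < H → p k = p' k) (π : Policy S A H) :
    oldFeasibleSet p π = oldFeasibleSet p' π := by
  simp only [oldFeasibleSet, qFun_congr_trans h]

theorem feasibleSet_congr_trans {p p' : Transition S A H}
    (h : ∀ k : Fin H, k.val + 1 < H → p k = p' k) (μ₀ : stdSimplex ℝ S) (π : Policy S A H) :
    feasibleSet μ₀ p π = feasibleSet μ₀ p' π := by
  simp only [feasibleSet, utility, qFun_congr_trans h]

theorem policyClass_congr {Z : Set (S × Fin H)} {π π' : Policy S A H}
    (h : ∀ x ∈ Z, π x.2 x.1 = π' x.2 x.1) : policyClass Z π = policyClass Z π' := by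
  ext π''
  exact forall₂_congr fun x hx => by rw [h x hx]

variable (M : Instance S A H)

theorem pacLearnable_subFeasible : PACLearnable M.sameExpert Instance.subFeasible := by
  refine pacLearnable_of_isClosed_rewardGraph
    (fun Z μ₀ p => ⋂ q ∈ transClass Z p, feasibleSet μ₀ q M.expert.toPolicy)
    (fun I hI => ?_)
    (fun Z => isClosed_rewardGraph_iInter_transClass Z (isClosed_rewardGraph_feasibleSet _))
    (fun Z μ₀ p p' h => iInter_transClass_congr
      (fun q q' hq => feasibleSet_congr_trans hq μ₀ _) h)
  rw [← hI.2.2]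
  rfl

theorem pacLearnable_superFeasible : PACLearnable M.sameExpert Instance.superFeasible := by
  refine pacLearnable_of_isClosed_rewardGraph
    (fun Z μ₀ p => ⋃ q ∈ transClass Z p, feasibleSet μ₀ q M.expert.toPolicy)
    (fun I hI => ?_)
    (fun Z => isClosed_rewardGraph_iUnion_transClass Z (isClosed_rewardGraph_feasibleSet _))
    (fun Z μ₀ p p' h => iUnion_transClass_congr
      (fun q q' hq => feasibleSet_congr_trans hq μ₀ _) h)
  rw [← hI.2.2]
  rfl

variable {M} in
theorem policyClass_expert_eq {I : Instance S A H} (hI : I ∈ M.sameExpertOnSupp) :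
    policyClass I.expertSupp I.expert.toPolicy = policyClass M.expertSupp M.expert.toPolicy := by
  rw [hI.2.1]
  refine policyClass_congr fun x hx => ?_
  simp only [DetPolicy.toPolicy, hI.2.2 x hx]

theorem pacLearnable_oldSubFeasible :
    PACLearnable M.sameExpertOnSupp Instance.oldSubFeasible := by
  refine pacLearnable_of_isClosed_rewardGraph
    (fun Z _ p => ⋂ q ∈ transClass Z p,
      ⋂ π' ∈ policyClass M.expertSupp M.expert.toPolicy, oldFeasibleSet q π')
    (fun I hI => ?_)
    (fun Z => isClosed_rewardGraph_iInter_transClass Z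
      (isClosed_rewardGraph_iInter_policyClass _ _))
    (fun Z μ₀ p p' h => iInter_transClass_congr
      (fun q q' hq => by simp only [oldFeasibleSet_congr_trans hq]) h)
  rw [Instance.oldSubFeasible, policyClass_expert_eq hI]

theorem pacLearnable_oldSuperFeasible :
    PACLearnable M.sameExpertOnSupp Instance.oldSuperFeasible := by
  refine pacLearnable_of_isClosed_rewardGraph
    (fun Z _ p => ⋃ q ∈ transClass Z p,
      ⋃ π' ∈ policyClass M.expertSupp M.expert.toPolicy, oldFeasibleSet q π')
    (fun I hI => ?_)
    (fun Z => isClosed_rewardGraph_iUnion_transClass Z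
      (isClosed_rewardGraph_iUnion_policyClass _ _))
    (fun Z μ₀ p p' h => iUnion_transClass_congr
      (fun q q' hq => by simp only [oldFeasibleSet_congr_trans hq]) h)
  rw [Instance.oldSuperFeasible, policyClass_expert_eq hI]

end LearnableOfClosedGraph

theorem toPolicy_pos_iff {S A : Type*} [Fintype A] {H : ℕ} (π : DetPolicy S A H) {k : Fin H} {s : S} {a : A} :
    0 < π.toPolicy k s a ↔ a = π k s := by
  classical
  change 0 < (Pi.single (π k s) 1 : A → ℝ) a ↔ _
  rw [Pi.single_apply]
  split_ifs with h <;> simp [h]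

/-! ### Instances with the same law, and tightness for the feasible set -/

section Indistinguishable

variable {S A : Type*} [Fintype S] [Fintype A] {H : ℕ} [NeZero H]

/-- A learnable set takes the same value on instances with the same law of the trajectories. -/
theorem PACLearnable.eq_of_law_eq {C : Set (Instance S A H)}
    {ψ : Instance S A H → Set (Reward S A H)} (hψ : PACLearnable C ψ) {I I' : Instance S A H}
    (hI : I ∈ C) (hI' : I' ∈ C) (hlaw : I.law = I'.law) : ψ I = ψ I' := by
  obtain ⟨d, hd, alg, halg⟩ := hψ
  obtain ⟨ρ, hρ⟩ := hd.relaxed_triangle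
  have hbound : ∀ ε ∈ Set.Ioo (0 : ℝ) 1, d (ψ I) (ψ I') ≤ |ρ| * (2 * ε) := by
    intro ε hε
    obtain ⟨N, hN⟩ := halg I hI ε hε (1 / 3) (by norm_num)
    obtain ⟨N', hN'⟩ := halg I' hI' ε hε (1 / 3) (by norm_num)
    have h1 := hN (max N N') (le_max_left _ _)
    have h2 := hN' (max N N') (le_max_right _ _)
    rw [← hlaw] at h2
    -- Under the common law both events have probability at least 2/3, so some sample lies in both.
    have hnot : ¬ Disjoint {x | d (ψ I) (alg (max N N') x) ≤ ε}
        {x | d (ψ I') (alg (max N N') x) ≤ ε} := by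
      intro hdisj
      have := iidProb_add_le_one (trajProb_nonneg I.init I.trans I.behavior) hdisj
        (sum_trajProb I.init I.trans I.behavior)
      change iidProb I.law _ + iidProb I.law _ ≤ 1 at this
      linarith
    obtain ⟨x, hx1, hx2⟩ := Set.not_disjoint_iff.1 hnot
    rw [Set.mem_ofPred_eq] at hx1 hx2
    rw [hd.symm] at hx2
    have h0 := hd.nonneg (ψ I) (alg (max N N') x)
    have h0' := hd.nonneg (alg (max N N') x) (ψ I')
    calc d (ψ I) (ψ I') ≤ ρ * (d (ψ I) (alg _ x) + d (alg _ x) (ψ I')) := hρ _ _ _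
      _ ≤ |ρ| * (d (ψ I) (alg _ x) + d (alg _ x) (ψ I')) :=
          mul_le_mul_of_nonneg_right (le_abs_self ρ) (by linarith)
      _ ≤ |ρ| * (2 * ε) := mul_le_mul_of_nonneg_left (by linarith) (abs_nonneg ρ)
  rw [← hd.eq_zero_iff]
  refine le_antisymm (le_of_forall_pos_le_add fun t ht => ?_) (hd.nonneg _ _)
  -- The choice `ε = t / (2 * |ρ| + 2 * t + 1)` is below 1 and gives `2 * |ρ| * ε ≤ t`.
  have hden : 0 < 2 * |ρ| + 2 * t + 1 := by positivity
  have hε : t / (2 * |ρ| + 2 * t + 1) ∈ Set.Ioo (0 : ℝ) 1 :=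
    ⟨by positivity, by rw [div_lt_one hden]; linarith [abs_nonneg ρ]⟩
  refine (hbound _ hε).trans ?_
  rw [zero_add, ← mul_assoc, mul_div_assoc', div_le_iff₀ hden]
  nlinarith [abs_nonneg ρ]

/-- In the forward recursion, unvisited pairs have weight zero and visited pairs keep their
transitions. -/
theorem visitSA_eq_of_mem_transClass {μ₀ : stdSimplex ℝ S} {p p' : Transition S A H}
    {π : Policy S A H} (h : p' ∈ transClass (suppSA μ₀ p π) p) (k : Fin H) (s : S) (a : A) :
    visitSA μ₀ p' π k s a = visitSA μ₀ p π k s a := by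
  revert s a
  induction k using stage_induction with
  | zero => intro s a; rw [visitSA_zero, visitSA_zero]
  | succ k hk ih =>
    intro s' a'
    rw [visitSA_succ, visitSA_succ]
    congr 1
    refine Finset.sum_congr rfl fun s _ => Finset.sum_congr rfl fun a _ => ?_
    rw [ih]
    rcases (visitSA_nonneg μ₀ p π k s a).eq_or_lt with h0 | hpos
    · rw [← h0, zero_mul, zero_mul]
    · rw [h (s, a, k) hpos]

/-- Changing the transitions outside the visited pairs does not change the law of the
trajectories. -/
theorem trajProb_eq_of_mem_transClass {μ₀ : stdSimplex ℝ S} {p p' : Transition S A H}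
    {π : Policy S A H} (h : p' ∈ transClass (suppSA μ₀ p π) p) (τ : Traj S A H) :
    trajProb μ₀ p' π τ = trajProb μ₀ p π τ := by
  have hvisit : (∀ k, 0 < visitSA μ₀ p π k (τ k).1 (τ k).2) →
      trajProb μ₀ p' π τ = trajProb μ₀ p π τ := by
    intro hpos
    unfold trajProb
    congr 1
    refine Finset.prod_congr rfl fun k _ => ?_
    rw [h ((τ k).1, (τ k).2, k) (hpos k)]
  -- A trajectory of positive probability under either model has all its pairs visited, as visit
  -- probabilities agree; otherwise both probabilities vanish.
  rcases (trajProb_nonneg μ₀ p π τ).eq_or_lt with h0 | hpos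
  · rcases (trajProb_nonneg μ₀ p' π τ).eq_or_lt with h0' | hpos'
    · rw [← h0, ← h0']
    · refine hvisit fun k => ?_
      rw [← visitSA_eq_of_mem_transClass h]
      exact (visitSA_pos_iff μ₀ p' π).2 ⟨τ, rfl, hpos'⟩
  · exact hvisit fun k => (visitSA_pos_iff μ₀ p π).2 ⟨τ, rfl, hpos⟩

/-- Under the covering condition, whatever the expert visits is visited by the behavioral
policy. -/
theorem Instance.Covers.mem_behaviorSupp {I : Instance S A H} (hI : I.Covers) {k : Fin H} {s : S}
    {a : A} (h : 0 < visitSA I.init I.trans I.expert.toPolicy k s a) :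
    (s, a, k) ∈ I.behaviorSupp := by
  change 0 < visitSA I.init I.trans I.behavior k s a
  revert s a
  induction k using stage_induction with
  | zero =>
    intro s a h
    rw [visitSA_pos_iff_visitS] at h ⊢
    rw [visitS_zero] at h ⊢
    obtain rfl := (toPolicy_pos_iff _).1 h.2
    exact ⟨h.1, hI (s, 0) (by simpa [Instance.expertSupp, suppS, visitS_zero] using h.1)⟩
  | succ k hk ih =>
    intro s' a' h
    rw [visitSA_pos_iff_visitS] at h ⊢
    obtain rfl := (toPolicy_pos_iff _).1 h.2
    refine ⟨?_, hI (s', ⟨k.val + 1, hk⟩) h.1⟩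
    have h1 := h.1
    rw [visitS_succ] at h1 ⊢
    have hnn : ∀ (π : Policy S A H) (s : S) (a : A),
        0 ≤ visitSA I.init I.trans π k s a * I.trans k s a s' := fun π s a =>
      mul_nonneg (visitSA_nonneg _ _ _ _ _ _) ((I.trans k s a).2.1 s')
    obtain ⟨s, -, hs⟩ := (Finset.sum_pos_iff_of_nonneg fun s _ =>
      Finset.sum_nonneg fun a _ => hnn _ s a).1 h1
    obtain ⟨a, -, ha⟩ := (Finset.sum_pos_iff_of_nonneg fun a _ => hnn _ s a).1 hs
    refine Finset.sum_pos' (fun s _ => Finset.sum_nonneg fun a _ => hnn _ s a)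
      ⟨s, Finset.mem_univ s, Finset.sum_pos' (fun a _ => hnn _ s a) ⟨a, Finset.mem_univ a, ?_⟩⟩
    exact mul_pos (ih (pos_of_mul_pos_left ha ((I.trans k s a).2.1 s')))
      (pos_of_mul_pos_right ha (visitSA_nonneg _ _ _ _ _ _))

theorem visitS_eq_of_eqOn {μ₀ : stdSimplex ℝ S} {p p' : Transition S A H} {π π' : Policy S A H}
    (hp : p' ∈ transClass (suppSA μ₀ p π) p) (hπ : π' ∈ policyClass (suppS μ₀ p π) π)
    (k : Fin H) (s : S) : visitS μ₀ p' π' k s = visitS μ₀ p π k s := by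
  revert s
  induction k using stage_induction with
  | zero => intro s; rw [visitS_zero, visitS_zero]
  | succ k hk ih =>
    intro s'
    rw [visitS_succ, visitS_succ]
    refine Finset.sum_congr rfl fun s _ => Finset.sum_congr rfl fun a _ => ?_
    rw [visitSA_eq_visitS_mul μ₀ p', ih]
    rcases (visitS_nonneg μ₀ p π k s).eq_or_lt with h0 | hpos
    · rw [visitSA_eq_visitS_mul, ← h0]
      simp only [zero_mul]
    · rw [← hπ (s, k) hpos, ← visitSA_eq_visitS_mul]
      rcases (visitSA_nonneg μ₀ p π k s a).eq_or_lt with h0 | hpos'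
      · rw [← h0, zero_mul, zero_mul]
      · rw [hp (s, a, k) hpos']

/-- The instance with other transitions and another expert. -/
def Instance.modify (I : Instance S A H) (p' : Transition S A H) (π' : DetPolicy S A H) :
    Instance S A H where
  init := I.init
  trans := p'
  expert := π'
  behavior := I.behavior

variable {I : Instance S A H} {p' : Transition S A H} {π' : DetPolicy S A H}

theorem Instance.law_modify (hp : p' ∈ transClass I.behaviorSupp I.trans) :
    (I.modify p' π').law = I.law :=
  funext fun τ => trajProb_eq_of_mem_transClass hp τ

/-- Covering puts the expert's visited pairs inside the behavioral support, so `p'` agrees with the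
transitions wherever the expert goes. -/
theorem Instance.Covers.expertSupp_modify (hI : I.Covers)
    (hp : p' ∈ transClass I.behaviorSupp I.trans)
    (hπ : ∀ x ∈ I.expertSupp, I.expert x.2 x.1 = π' x.2 x.1) :
    (I.modify p' π').expertSupp = I.expertSupp := by
  have hv := visitS_eq_of_eqOn (p' := p') (π' := π'.toPolicy)
    (fun x hx => hp x (hI.mem_behaviorSupp (k := x.2.2) (s := x.1) (a := x.2.1) hx))
    (fun x hx => by simp only [DetPolicy.toPolicy, hπ x hx])
  ext x
  change 0 < visitS I.init p' π'.toPolicy x.2 x.1 ↔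
    0 < visitS I.init I.trans I.expert.toPolicy x.2 x.1
  rw [hv]

theorem Instance.Covers.modify (hI : I.Covers)
    (hp : p' ∈ transClass I.behaviorSupp I.trans)
    (hπ : ∀ x ∈ I.expertSupp, I.expert x.2 x.1 = π' x.2 x.1) :
    (I.modify p' π').Covers := by
  intro x hx
  rw [hI.expertSupp_modify hp hπ] at hx
  change 0 < I.behavior x.2 x.1 (π' x.2 x.1)
  rw [← hπ x hx]
  exact hI x hx

variable {M : Instance S A H} {μ₀ : stdSimplex ℝ S} {πb : Policy S A H}

theorem modify_mem_slice_sameExpertOnSupp (hI : I ∈ slice M.sameExpertOnSupp μ₀ πb)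
    (hp : p' ∈ transClass I.behaviorSupp I.trans)
    (hπ : ∀ x ∈ I.expertSupp, I.expert x.2 x.1 = π' x.2 x.1) :
    I.modify p' π' ∈ slice M.sameExpertOnSupp μ₀ πb := by
  refine ⟨⟨hI.1.1.modify hp hπ, ?_, fun x hx => ?_⟩, hI.2⟩
  · rw [hI.1.1.expertSupp_modify hp hπ, hI.1.2.1]
  · rw [← hI.1.2.2 x hx]
    exact (hπ x (hI.1.2.1 ▸ hx)).symm

theorem modify_mem_slice_sameExpert (hI : I ∈ slice M.sameExpert μ₀ πb)
    (hp : p' ∈ transClass I.behaviorSupp I.trans) :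
    I.modify p' I.expert ∈ slice M.sameExpert μ₀ πb := by
  refine ⟨⟨hI.1.1.modify hp fun _ _ => rfl, ?_, hI.1.2.2⟩, hI.2⟩
  rw [hI.1.1.expertSupp_modify hp fun _ _ => rfl, hI.1.2.1]

variable (I) in
theorem trans_mem_transClass : I.trans ∈ transClass I.behaviorSupp I.trans := fun _ _ => rfl

variable (I) in
theorem expert_mem_policyClass :
    I.expert.toPolicy ∈ policyClass I.expertSupp I.expert.toPolicy := fun _ _ => rfl

/-- Every `p'` in the class is realised by an instance of the same slice with the same law, where
`ψ` is unchanged and must satisfy the inclusion. -/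
theorem isTightestLearnableSubset_subFeasible (M : Instance S A H) :
    IsTightestLearnableSubset M.sameExpert Instance.feasible Instance.subFeasible := by
  refine ⟨pacLearnable_subFeasible M, fun I _ =>
    Set.biInter_subset_of_mem (trans_mem_transClass I), fun μ₀ πb ψ hψ hsub I hI =>
      Set.subset_iInter₂ fun p' hp => ?_⟩
  have hI' := modify_mem_slice_sameExpert hI hp
  rw [hψ.eq_of_law_eq hI hI' (Instance.law_modify hp).symm]
  exact hsub _ hI'

theorem isTightestLearnableSuperset_superFeasible (M : Instance S A H) :
    IsTightestLearnableSuperset M.sameExpert Instance.feasible Instance.superFeasible := by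
  refine ⟨pacLearnable_superFeasible M, fun I _ => Set.subset_biUnion_of_mem
    (u := fun p' => feasibleSet I.init p' I.expert.toPolicy) (trans_mem_transClass I),
      fun μ₀ πb ψ hψ hsub I hI => Set.iUnion₂_subset fun p' hp => ?_⟩
  have hI' := modify_mem_slice_sameExpert hI hp
  rw [hψ.eq_of_law_eq hI hI' (Instance.law_modify hp).symm]
  exact hsub _ hI'

end Indistinguishable

/-! ### Stochastic versus deterministic extensions of the expert -/

section PolicyClass

variable {S A : Type*} [Fintype S] [Fintype A] {H : ℕ}

/-- An average that dominates every value puts mass only on maximisers; otherwise it would be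
smaller than itself. -/
theorem le_of_forall_le_sum_mul {w : stdSimplex ℝ A} {f : A → ℝ} {a : A}
    (h : ∀ b, f b ≤ ∑ b', w b' * f b') (ha : 0 < w a) (b : A) : f b ≤ f a := by
  refine (h b).trans (not_lt.1 fun hlt => ?_)
  set m := ∑ b', w b' * f b' with hm
  have : ∑ b', w b' * f b' < ∑ b', w b' * m :=
    Finset.sum_lt_sum (fun b' _ => mul_le_mul_of_nonneg_left (h b') (w.2.1 b'))
      ⟨a, Finset.mem_univ a, mul_lt_mul_of_pos_left hlt ha⟩
  rw [← Finset.sum_mul, stdSimplex.sum_eq_one, one_mul] at this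
  exact lt_irrefl _ this

theorem sum_mul_eq_of_forall_le {w : stdSimplex ℝ A} {f : A → ℝ} {m : ℝ}
    (h : ∀ a, 0 < w a → f a = m) : ∑ a, w a * f a = m := by
  have : ∀ a, w a * f a = w a * m := by
    intro a
    rcases (w.2.1 a).eq_or_lt with h0 | hpos
    · change 0 = w a at h0
      rw [← h0, zero_mul, zero_mul]
    · rw [h a hpos]
  simp only [this, ← Finset.sum_mul, stdSimplex.sum_eq_one, one_mul]

variable {p : Transition S A H} {π π' : Policy S A H} {r : Reward S A H}

theorem exists_pos_stdSimplex (w : stdSimplex ℝ A) : ∃ a, 0 < w a := by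
  by_contra! h
  have h1 := Finset.sum_nonpos fun a (_ : a ∈ Finset.univ) => h a
  rw [stdSimplex.sum_eq_one] at h1
  exact absurd h1 (by norm_num)

/-- A policy which draws only actions that are optimal for an optimal policy has the same
Q-function. -/
theorem qFun_eq_of_greedy (hr : r ∈ oldFeasibleSet p π)
    (hg : ∀ h s a, 0 < π' h s a → ∀ b, qFun p π r h s b ≤ qFun p π r h s a) (h : Fin H) (s : S)
    (a : A) : qFun p π' r h s a = qFun p π r h s a := by
  induction hn : H - h.val generalizing h s a with
  | zero => omega
  | succ n ih =>
    rw [qFun, qFun]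
    by_cases hk : h.val + 1 < H
    · rw [dif_pos hk, dif_pos hk]
      congr 1
      refine Finset.sum_congr rfl fun s' _ => ?_
      congr 1
      refine sum_mul_eq_of_forall_le fun a' ha' => ?_
      rw [ih ⟨h.val + 1, hk⟩ s' a' (by simp; omega)]
      obtain ⟨b, hb⟩ := exists_pos_stdSimplex (π ⟨h.val + 1, hk⟩ s')
      have hopt : ∀ c, 0 < π ⟨h.val + 1, hk⟩ s' c →
          qFun p π r ⟨h.val + 1, hk⟩ s' c = qFun p π r ⟨h.val + 1, hk⟩ s' a' := fun c hc =>
        le_antisymm (hg _ _ _ ha' c) (le_of_forall_le_sum_mul (hr _ _) hc a')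
      exact (sum_mul_eq_of_forall_le hopt).symm
    · rw [dif_neg hk, dif_neg hk]

theorem mem_oldFeasibleSet_of_greedy (hr : r ∈ oldFeasibleSet p π)
    (hg : ∀ h s a, 0 < π' h s a → ∀ b, qFun p π r h s b ≤ qFun p π r h s a) :
    r ∈ oldFeasibleSet p π' := by
  intro h s b
  simp only [qFun_eq_of_greedy hr hg]
  obtain ⟨a, ha⟩ := exists_pos_stdSimplex (π' h s)
  have hopt : ∀ c, 0 < π' h s c → qFun p π r h s c = qFun p π r h s a := fun c hc =>
    le_antisymm (hg _ _ _ ha c) (hg _ _ _ hc a)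
  rw [sum_mul_eq_of_forall_le hopt]
  exact hg _ _ _ ha b

theorem qFun_congr_policy {h : Fin H} (hπ : ∀ k : Fin H, h < k → π k = π' k) (s : S) (a : A) :
    qFun p π r h s a = qFun p π' r h s a := by
  induction hn : H - h.val generalizing h s a with
  | zero => omega
  | succ n ih =>
    rw [qFun, qFun]
    by_cases hk : h.val + 1 < H
    · have hlt : h < ⟨h.val + 1, hk⟩ := Fin.lt_def.2 (by simp)
      rw [dif_pos hk, dif_pos hk, hπ _ hlt]
      congr 1
      refine Finset.sum_congr rfl fun s' _ => ?_
      congr 1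
      refine Finset.sum_congr rfl fun a' _ => ?_
      rw [ih (fun k hk' => hπ k (hlt.trans hk')) s' a' (by simp; omega)]
    · rw [dif_neg hk, dif_neg hk]

variable {Z : Set (S × Fin H)} {σ : DetPolicy S A H}

/-- A reward compatible with every deterministic extension of the expert's policy is compatible
with every stochastic extension. -/
theorem mem_oldFeasibleSet_of_forall_det
    (hr : ∀ σ' : DetPolicy S A H, (∀ x ∈ Z, σ x.2 x.1 = σ' x.2 x.1) →
      r ∈ oldFeasibleSet p σ'.toPolicy)
    (hπ : π' ∈ policyClass Z σ.toPolicy) : r ∈ oldFeasibleSet p π' := by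
  classical
  have hσ := hr σ fun _ _ => rfl
  refine mem_oldFeasibleSet_of_greedy hσ fun h s a ha b => ?_
  by_cases hx : (s, h) ∈ Z
  · rw [← hπ (s, h) hx] at ha
    exact le_of_forall_le_sum_mul (hσ h s) ha b
  -- Altering `σ` at the single point `(s, h)` outside `Z` leaves an extension of the expert and
  -- does not change Q at stage `h`, which sees only later stages. Compatibility with `σ'` then says
  -- that `a` maximises the Q-function of `σ`.
  · let σ' : DetPolicy S A H := Function.update σ h (Function.update (σ h) s a)
    have hσ' : ∀ x ∈ Z, σ x.2 x.1 = σ' x.2 x.1 := by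
      rintro ⟨t, k⟩ hxZ
      by_cases hk : k = h
      · subst hk
        have hts : t ≠ s := by
          rintro rfl
          exact hx hxZ
        simp [σ', hts]
      · simp [σ', hk]
    have hq : ∀ c, qFun p σ'.toPolicy r h s c = qFun p σ.toPolicy r h s c := fun c =>
      qFun_congr_policy (fun k hk => by
        funext t
        simp [DetPolicy.toPolicy, σ', hk.ne']) s c
    have hpos : 0 < σ'.toPolicy h s a := (toPolicy_pos_iff _).2 (by simp [σ'])
    have := le_of_forall_le_sum_mul (hr σ' hσ' h s) hpos b
    rwa [hq, hq] at this

/-- A reward compatible with a stochastic extension of the expert's policy is compatible with a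
deterministic one. -/
theorem exists_det_mem_oldFeasibleSet (hr : r ∈ oldFeasibleSet p π')
    (hπ : π' ∈ policyClass Z σ.toPolicy) :
    ∃ σ' : DetPolicy S A H, (∀ x ∈ Z, σ x.2 x.1 = σ' x.2 x.1) ∧
      r ∈ oldFeasibleSet p σ'.toPolicy := by
  classical
  -- Any action drawn with positive probability is a maximiser, and on `Z` the expert's action is
  -- the only one available.
  choose f hf using fun (h : Fin H) (s : S) => exists_pos_stdSimplex (π' h s)
  refine ⟨f, fun x hx => ?_, mem_oldFeasibleSet_of_greedy hr fun h s a ha b => ?_⟩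
  · have h1 := hf x.2 x.1
    rw [← hπ x hx] at h1
    exact ((toPolicy_pos_iff _).1 h1).symm
  · obtain rfl := (toPolicy_pos_iff _).1 ha
    exact le_of_forall_le_sum_mul (hr h s) (hf h s) b

variable [NeZero H]

/-- Instances carry deterministic experts only, so indistinguishability covers the deterministic
extensions and `mem_oldFeasibleSet_of_forall_det` supplies the stochastic ones. -/
theorem isTightestLearnableSubset_oldSubFeasible (M : Instance S A H) :
    IsTightestLearnableSubset M.sameExpertOnSupp Instance.oldFeasible
      Instance.oldSubFeasible := by
  refine ⟨pacLearnable_oldSubFeasible M, fun I _ =>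
    (Set.biInter_subset_of_mem (trans_mem_transClass I)).trans
      (Set.biInter_subset_of_mem (expert_mem_policyClass I)), fun μ₀ πb ψ hψ hsub I hI =>
        Set.subset_iInter₂ fun p' hp => Set.subset_iInter₂ fun π' hπ r hr =>
          mem_oldFeasibleSet_of_forall_det (fun σ' hσ' => ?_) hπ⟩
  have hI' := modify_mem_slice_sameExpertOnSupp hI hp hσ'
  rw [hψ.eq_of_law_eq hI hI' (Instance.law_modify hp).symm] at hr
  exact hsub _ hI' hr

theorem isTightestLearnableSuperset_oldSuperFeasible (M : Instance S A H) :
    IsTightestLearnableSuperset M.sameExpertOnSupp Instance.oldFeasible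
      Instance.oldSuperFeasible := by
  refine ⟨pacLearnable_oldSuperFeasible M, fun I _ r hr => Set.mem_biUnion
    (trans_mem_transClass I) (Set.mem_biUnion (expert_mem_policyClass I) hr),
      fun μ₀ πb ψ hψ hsub I hI => Set.iUnion₂_subset fun p' hp =>
        Set.iUnion₂_subset fun π' hπ r hr => ?_⟩
  obtain ⟨σ', hσ', hrσ⟩ := exists_det_mem_oldFeasibleSet hr hπ
  have hI' := modify_mem_slice_sameExpertOnSupp hI hp hσ'
  rw [hψ.eq_of_law_eq hI hI' (Instance.law_modify hp).symm]
  exact hsub _ hI' hrσ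

end PolicyClass

end OfflineIRL

theorem theoremD2 {S A : Type*} [Fintype S] [Fintype A] {H : ℕ} [NeZero H]
    (M : OfflineIRL.Instance S A H) :
    (OfflineIRL.IsTightestLearnableSubset M.sameExpertOnSupp
        OfflineIRL.Instance.oldFeasible OfflineIRL.Instance.oldSubFeasible ∧
      OfflineIRL.IsTightestLearnableSuperset M.sameExpertOnSupp
        OfflineIRL.Instance.oldFeasible OfflineIRL.Instance.oldSuperFeasible) ∧
    (OfflineIRL.IsTightestLearnableSubset M.sameExpert
        OfflineIRL.Instance.feasible OfflineIRL.Instance.subFeasible ∧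
      OfflineIRL.IsTightestLearnableSuperset M.sameExpert
        OfflineIRL.Instance.feasible OfflineIRL.Instance.superFeasible) := by
  exact ⟨⟨OfflineIRL.isTightestLearnableSubset_oldSubFeasible M,
      OfflineIRL.isTightestLearnableSuperset_oldSuperFeasible M⟩,
    OfflineIRL.isTightestLearnableSubset_subFeasible M,
    OfflineIRL.isTightestLearnableSuperset_superFeasible M⟩
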